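/- Let $-\infty<a<b<\infty$, $n\in\mathbb{N}\cup\{0\}$, $m,r\in\mathbb{N}=\{1,2,\dots\}$, $1\le p\le\infty$, and let $\mathcal{M}$ be an arbitrary metric space. For $k\ge 1$ let $W^k_p=W^k_p([a,b];\mathbb{C})$ be the Sobolev space of all $y\in C^{k-1}([a,b];\mathbb{C})$ such that $y^{(k-1)}$ is absolutely continuous and $y^{(k)}\in L_p$, put $W^0_p=L_p([a,b];\mathbb{C})$, and use the norm $\|y\|_{k,p}=\sum_{s=0}^{k}\|y^{(s)}\|_{p}$. The spaces $(W^k_p)^m$ and $(W^k_p)^{m\times m}$ of vector- and matrix-valued functions with components in $W^k_p$ are normed by the sum of the norms of the components. For every $\mu\in\mathcal{M}$ let matrix-valued functions $A_0(\cdot,\mu),\dots,A_{r-1}(\cdot,\mu)\in(W^n_p)^{m\times m}$ and a continuous linear operator $B(\mu)\colon(W^{n+r}_p)^m\to\mathbb{C}^{rm}$ be given, and let $f\in(W^n_p)^m$ and $c\in\mathbb{C}^{rm}$ be fixed, i.e. independent of $\mu$. Consider the boundary-value problem $$L(\mu)y:=y^{(r)}+\sum_{\ell=1}^{r}A_{r-\ell}(\cdot,\mu)\,y^{(r-\ell)}=f\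 \text{ on }(a,b),\qquad B(\mu)y=c,$$ where a solution is a function $y\in(W^{n+r}_p)^m$ that satisfies the differential equation everywhere on $(a,b)$ if $n\ge1$ and almost everywhere on $(a,b)$ if $n=0$, and satisfies $B(\mu)y=c$. Assume that for every $\mu_0\in\mathcal{M}$: (0) the homogeneous problem $L(\mu_0)y=0$ on $(a,b)$, $B(\mu_0)y=0$ has only the trivial solution in $(W^{n+r}_p)^m$; (I) $A_{r-\ell}(\cdot,\mu)\to A_{r-\ell}(\cdot,\mu_0)$ in $(W^n_p)^{m\times m}$ as $\mu\to\mu_0$, for every $\ell\in\{1,\dots,r\}$; (II) $B(\mu)y\to B(\mu_0)y$ in $\mathbb{C}^{rm}$ as $\mu\to\mu_0$, for every $y\in(W^{n+r}_p)^m$. Then for every $\mu\in\mathcal{M}$ the boundary-value problem has a unique solution $y(\cdot,\mu)\in(W^{n+r}_p)^m$, and the map $\mu\mapsto y(\cdot,\mu)$ belongs to $C\big(\mathcal{M};(W^{n+r}_p)^m\big)$, i.e. it is continuous from $\mathcal{M}$ to $(W^{n+r}_p)^m$. -/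

import Mathlib

open MeasureTheory Set Filter Topology
open scoped ENNReal

namespace SobolevBVP

/-- `y : ℝ → ℂ`, looked at on `[a, b]` only, is a Sobolev function of class `W^k_p([a,b]; ℂ)`:
for `k = 0` it lies in `L_p`; for `k ≥ 1` it is of class `C^{k-1}` on `[a, b]`, its derivative of
order `k - 1` is absolutely continuous on `[a, b]`, and its derivative of order `k` (which then
exists almost everywhere) lies in `L_p`. -/
def IsSobolevFun (p : ℝ≥0∞) (a b : ℝ) : ℕ → (ℝ → ℂ) → Prop
  | 0, y => MemLp y p (volume.restrict (Icc a b))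
  | k + 1, y =>
      ContDiffOn ℝ k y (Icc a b) ∧
      AbsolutelyContinuousOnInterval (iteratedDerivWithin k y (Icc a b)) a b ∧
      MemLp (iteratedDerivWithin (k + 1) y (Icc a b)) p (volume.restrict (Icc a b))

theorem absolutelyContinuousOnInterval_congr {f g : ℝ → ℂ} {a b : ℝ} (hab : a < b)
    (hf : AbsolutelyContinuousOnInterval f a b) (h : EqOn f g (Icc a b)) :
    AbsolutelyContinuousOnInterval g a b := by
  rw [absolutelyContinuousOnInterval_iff] at hf ⊢
  intro ε hε
  obtain ⟨δ, hδ, H⟩ := hf ε hε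
  refine ⟨δ, hδ, fun E hE hlt ↦ ?_⟩
  have := H E hE hlt
  rw [← uIcc_of_le hab.le] at h
  rwa [Finset.sum_congr rfl fun i hi ↦ by rw [← h (hE.1 i hi).1, ← h (hE.1 i hi).2]]

theorem ae_differentiableWithinAt_Icc {f : ℝ → ℂ} {a b : ℝ} (hab : a < b)
    (hf : AbsolutelyContinuousOnInterval f a b) :
    ∀ᵐ t ∂(volume.restrict (Icc a b)), DifferentiableWithinAt ℝ f (Icc a b) t := by
  have h := hf.boundedVariationOn.ae_differentiableAt_of_mem_uIcc
  rw [uIcc_of_le hab.le] at h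
  rw [ae_restrict_iff' measurableSet_Icc]
  filter_upwards [h] with t ht htI using (ht htI).differentiableWithinAt

theorem iteratedDerivWithin_add_ae {p : ℝ≥0∞} {a b : ℝ} (hab : a < b) {k : ℕ} {y z : ℝ → ℂ}
    (hy : IsSobolevFun p a b k y) (hz : IsSobolevFun p a b k z) {s : ℕ} (hs : s ≤ k) :
    iteratedDerivWithin s (y + z) (Icc a b) =ᵐ[volume.restrict (Icc a b)]
      iteratedDerivWithin s y (Icc a b) + iteratedDerivWithin s z (Icc a b) := by
  have hU := uniqueDiffOn_Icc hab
  cases k with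
  | zero =>
    obtain rfl : s = 0 := by omega
    simp
  | succ k =>
    have low : ∀ s ≤ k, ∀ t ∈ Icc a b, iteratedDerivWithin s (y + z) (Icc a b) t =
        (iteratedDerivWithin s y (Icc a b) + iteratedDerivWithin s z (Icc a b)) t := by
      intro s hs t ht
      have hsk : ((s : ℕ∞) : WithTop ℕ∞) ≤ ((k : ℕ∞) : WithTop ℕ∞) := by exact_mod_cast hs
      exact iteratedDerivWithin_add ht hU ((hy.1 t ht).of_le hsk) ((hz.1 t ht).of_le hsk)
    rcases Nat.lt_or_ge k s with h | h
    · obtain rfl : s = k + 1 := by omega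
      filter_upwards [ae_differentiableWithinAt_Icc hab hy.2.1,
        ae_differentiableWithinAt_Icc hab hz.2.1, ae_restrict_mem measurableSet_Icc]
        with t h1 h2 ht
      rw [Pi.add_apply, iteratedDerivWithin_succ, iteratedDerivWithin_succ,
        iteratedDerivWithin_succ, ← derivWithin_add h1 h2]
      exact derivWithin_congr (fun x hx ↦ low k le_rfl x hx) (low k le_rfl t ht)
    · filter_upwards [ae_restrict_mem measurableSet_Icc] with t ht using low s h t ht

theorem IsSobolevFun.add {p : ℝ≥0∞} {a b : ℝ} (hab : a < b) {k : ℕ} {y z : ℝ → ℂ}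
    (hy : IsSobolevFun p a b k y) (hz : IsSobolevFun p a b k z) :
    IsSobolevFun p a b k (y + z) := by
  have key := @iteratedDerivWithin_add_ae p a b hab k y z hy hz
  cases k with
  | zero => exact MemLp.add hy hz
  | succ k =>
    refine ⟨hy.1.add hz.1, absolutelyContinuousOnInterval_congr hab (hy.2.1.add hz.2.1) ?_,
      (memLp_congr_ae (key le_rfl)).2 (hy.2.2.add hz.2.2)⟩
    intro t ht
    exact (iteratedDerivWithin_add ht (uniqueDiffOn_Icc hab) (hy.1 t ht) (hz.1 t ht)).symm

theorem iteratedDerivWithin_smul_eq {a b : ℝ} (c : ℂ) (s : ℕ) (y : ℝ → ℂ) :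
    iteratedDerivWithin s (c • y) (Icc a b) = c • iteratedDerivWithin s y (Icc a b) := by
  ext t
  exact iteratedDerivWithin_const_smul_field c y

theorem IsSobolevFun.const_smul {p : ℝ≥0∞} {a b : ℝ} {k : ℕ} {y : ℝ → ℂ}
    (c : ℂ) (hy : IsSobolevFun p a b k y) : IsSobolevFun p a b k (c • y) := by
  cases k with
  | zero => exact MemLp.const_smul hy c
  | succ k =>
    refine ⟨hy.1.const_smul c, ?_, ?_⟩
    · rw [iteratedDerivWithin_smul_eq]
      exact hy.2.1.const_smul c
    · rw [iteratedDerivWithin_smul_eq]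
      exact hy.2.2.const_smul c

/-- The Sobolev space `W^k_p([a,b]; ℂ)`.  A Sobolev function `y`, taken modulo equality almost
everywhere on `[a, b]` (for `k ≥ 1` this is equality on `[a, b]`), is stored together with the
`L_p`-classes of its derivatives, as `(y, y', …, y^{(k)})`.  The norm inherited from the
`ℓ¹`-product of `k + 1` copies of `L_p` is `∑_{s ≤ k} ‖y^{(s)}‖_p`. -/
def sobolevSubmodule (k : ℕ) (p : ℝ≥0∞) [Fact (1 ≤ p)] (a b : ℝ) [Fact (a < b)] :
    Submodule ℂ (PiLp 1 fun _ : Fin (k + 1) ↦ Lp ℂ p (volume.restrict (Icc a b))) where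
  carrier := {u | ∃ y : ℝ → ℂ, IsSobolevFun p a b k y ∧
    ∀ s : Fin (k + 1),
      u s =ᵐ[volume.restrict (Icc a b)] iteratedDerivWithin (s : ℕ) y (Icc a b)}
  add_mem' := by
    rintro u v ⟨y, hy, hu⟩ ⟨z, hz, hv⟩
    have hab : a < b := Fact.out
    refine ⟨y + z, hy.add hab hz, fun s ↦ ?_⟩
    have h := iteratedDerivWithin_add_ae hab hy hz (Nat.lt_succ_iff.1 s.2)
    rw [PiLp.add_apply]
    exact (Lp.coeFn_add _ _).trans (((hu s).add (hv s)).trans h.symm)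
  zero_mem' := by
    refine ⟨0, ?_, fun s ↦ ?_⟩
    · have h0 : ∀ s, iteratedDerivWithin s (0 : ℝ → ℂ) (Icc a b) = 0 := fun s ↦ by
        simpa using iteratedDerivWithin_smul_eq (a := a) (b := b) 0 s 0
      cases k with
      | zero => exact MemLp.zero
      | succ k =>
        refine ⟨contDiffOn_const, ?_, ?_⟩
        · rw [h0]
          exact (contDiffOn_const (c := (0 : ℂ))).absolutelyContinuousOnInterval
        · rw [h0]
          exact MemLp.zero
    · have h0 : iteratedDerivWithin (s : ℕ) (0 : ℝ → ℂ) (Icc a b) = 0 := by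
        simpa using iteratedDerivWithin_smul_eq (a := a) (b := b) 0 (s : ℕ) 0
      rw [PiLp.zero_apply, h0]
      exact Lp.coeFn_zero _ _ _
  smul_mem' := by
    rintro c u ⟨y, hy, hu⟩
    refine ⟨c • y, hy.const_smul c, fun s ↦ ?_⟩
    rw [PiLp.smul_apply, iteratedDerivWithin_smul_eq]
    exact (Lp.coeFn_smul _ _).trans ((hu s).const_smul c)

/-- `W^k_p([a,b]; ℂ)` with the norm `∑_{s ≤ k} ‖y^{(s)}‖_p`. -/
abbrev Sobolev (k : ℕ) (p : ℝ≥0∞) [Fact (1 ≤ p)] (a b : ℝ) [Fact (a < b)] : Type :=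
  sobolevSubmodule k p a b

/-- `(W^k_p)^m`, normed by the sum of the norms of the components. -/
abbrev SobolevVec (m k : ℕ) (p : ℝ≥0∞) [Fact (1 ≤ p)] (a b : ℝ) [Fact (a < b)] : Type :=
  PiLp 1 fun _ : Fin m ↦ Sobolev k p a b

/-- `(W^k_p)^{m × m}`, normed by the sum of the norms of the entries. -/
abbrev SobolevMat (m k : ℕ) (p : ℝ≥0∞) [Fact (1 ≤ p)] (a b : ℝ) [Fact (a < b)] : Type :=
  PiLp 1 fun _ : Fin m × Fin m ↦ Sobolev k p a b

section

variable {p : ℝ≥0∞} [Fact (1 ≤ p)] {a b : ℝ} [Fact (a < b)] {m n r k : ℕ}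

/-- The function on `[a, b]` that an element of `W^k_p` stands for: for `k ≥ 1` its values on
`[a, b]` are uniquely determined, for `k = 0` they are determined almost everywhere. -/
noncomputable def Sobolev.toFun (u : Sobolev k p a b) : ℝ → ℂ :=
  Classical.choose u.2

theorem Sobolev.toFun_spec (u : Sobolev k p a b) :
    IsSobolevFun p a b k u.toFun ∧ ∀ s : Fin (k + 1),
      u.1 s =ᵐ[volume.restrict (Icc a b)] iteratedDerivWithin (s : ℕ) u.toFun (Icc a b) :=
  Classical.choose_spec u.2

/-- The derivative `u^{(s)}(t)` of an element of `W^k_p`, for `s ≤ k` and `t ∈ [a, b]` (for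
`s = k` it is determined almost everywhere). -/
noncomputable def Sobolev.deriv (s : ℕ) (u : Sobolev k p a b) (t : ℝ) : ℂ :=
  iteratedDerivWithin s u.toFun (Icc a b) t

/-- The `i`-th component of `(L y)(t) = y^{(r)}(t) + ∑_{l < r} A_l(t) y^{(l)}(t)`. -/
noncomputable def diffExpr (A : Fin r → SobolevMat m n p a b) (y : SobolevVec m (n + r) p a b)
    (t : ℝ) (i : Fin m) : ℂ :=
  Sobolev.deriv r (y i) t +
    ∑ l : Fin r, ∑ j : Fin m, (A l (i, j)).toFun t * Sobolev.deriv (l : ℕ) (y j) t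

/-- `L y = f` on `(a, b)`: everywhere if `n ≥ 1`, almost everywhere if `n = 0`. -/
def SolvesSystem (A : Fin r → SobolevMat m n p a b) (f : SobolevVec m n p a b)
    (y : SobolevVec m (n + r) p a b) : Prop :=
  (1 ≤ n → ∀ t ∈ Ioo a b, ∀ i, diffExpr A y t i = (f i).toFun t) ∧
  (n = 0 → ∀ᵐ t ∂(volume.restrict (Ioo a b)), ∀ i, diffExpr A y t i = (f i).toFun t)

/-- `y ∈ (W^{n+r}_p)^m` solves the boundary-value problem `L y = f` on `(a, b)`, `B y = c`. -/
def IsSolution (A : Fin r → SobolevMat m n p a b)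
    (B : SobolevVec m (n + r) p a b →L[ℂ] EuclideanSpace ℂ (Fin (r * m)))
    (f : SobolevVec m n p a b) (c : EuclideanSpace ℂ (Fin (r * m)))
    (y : SobolevVec m (n + r) p a b) : Prop :=
  SolvesSystem A f y ∧ B y = c

/-- Condition (0): the homogeneous problem `L y = 0`, `B y = 0` has only the trivial solution. -/
def ConditionZero (A : Fin r → SobolevMat m n p a b)
    (B : SobolevVec m (n + r) p a b →L[ℂ] EuclideanSpace ℂ (Fin (r * m))) : Prop :=
  ∀ y, IsSolution A B 0 0 y → y = 0

/-- Limit Condition (I) at `μ₀`: every coefficient converges in `(W^n_p)^{m × m}`. -/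
def LimitConditionI {M : Type*} [MetricSpace M] (A : M → Fin r → SobolevMat m n p a b)
    (μ₀ : M) : Prop :=
  ∀ l : Fin r, Tendsto (fun μ ↦ A μ l) (𝓝 μ₀) (𝓝 (A μ₀ l))

/-- Limit Condition (II) at `μ₀`: the boundary operators converge strongly. -/
def LimitConditionII {M : Type*} [MetricSpace M]
    (B : M → SobolevVec m (n + r) p a b →L[ℂ] EuclideanSpace ℂ (Fin (r * m))) (μ₀ : M) : Prop :=
  ∀ y, Tendsto (fun μ ↦ B μ y) (𝓝 μ₀) (𝓝 (B μ₀ y))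

end

end SobolevBVP

/-! Adjoin to `L(μ)` the values at `a` of the derivatives of order less than `r`. The resulting
Cauchy operator `T(μ)`, from `(W^{n+r}_p)^m` to `(W^n_p)^m × ℂ^{rm}`, is an isomorphism
(`systemOp_prod_initialOp_bijective`). It is continuous in `μ` for the operator norm, because the
coefficients enter linearly through a bounded product `W^n_p × W^{n+1}_p → W^n_p` (`Sobolev.mul`,
`continuous_systemOp`). Hence `S(μ) = T(μ)⁻¹` is norm continuous as well.

The solutions of `L(μ)y = f` are the `S(μ)(f, q)`, with `q` the initial data. The boundary condition
becomes `N(μ)q = c - B(μ)S(μ)(f, 0)` with `N(μ)q = B(μ)S(μ)(0, q)`, a square linear system of size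
`rm`. Condition (0) makes `N(μ)` injective, hence invertible. By Banach–Steinhaus, strong continuity
of `B` suffices for `N`, the right-hand side, `q` and the solution to be continuous in `μ`
(`exists_continuous_solution`).

For the bijectivity of `T(μ)`, reduce to zero initial data: then `v = y^{(r)}` satisfies `v + Kv =
f` in `L_p`, where `K` is a Volterra operator whose powers decay factorially (`volterra_bijective`),
and a bootstrap (`exists_regular`) lifts `v` from `L_p` to `W^n_p`. Throughout, `W^k_p` is handled
as the space of chains of `L_p` classes in which each term is a constant plus the primitive of the
next (`mem_sobolevSubmodule_iff`). -/

namespace SobolevBVP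

/-! ### Absolutely continuous complex functions and their primitives. -/

section

/-- Passes from real to complex values: the increments of a primitive of `f` are dominated by those
of a primitive of `‖f‖`. -/
theorem absolutelyContinuousOnInterval_of_dist_le {f : ℝ → ℂ} {g : ℝ → ℝ} {a b : ℝ}
    (hg : AbsolutelyContinuousOnInterval g a b)
    (h : ∀ x ∈ uIcc a b, ∀ y ∈ uIcc a b, dist (f x) (f y) ≤ dist (g x) (g y)) :
    AbsolutelyContinuousOnInterval f a b := by
  rw [absolutelyContinuousOnInterval_iff] at hg ⊢
  intro ε hε
  obtain ⟨δ, hδ, H⟩ := hg ε hε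
  refine ⟨δ, hδ, fun E hE hlt ↦ (Finset.sum_le_sum fun i hi ↦ ?_).trans_lt (H E hE hlt)⟩
  exact h _ (hE.1 i hi).1 _ (hE.1 i hi).2

theorem intervalIntegrable_of_mem {f : ℝ → ℂ} {a b x y : ℝ}
    (hf : IntervalIntegrable f volume a b) (hx : x ∈ uIcc a b) (hy : y ∈ uIcc a b) :
    IntervalIntegrable f volume x y :=
  hf.mono_set (uIcc_subset_uIcc hx hy)

theorem absolutelyContinuousOnInterval_integral {f : ℝ → ℂ} {a b : ℝ}
    (hf : IntervalIntegrable f volume a b) :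
    AbsolutelyContinuousOnInterval (fun x ↦ ∫ v in a..x, f v) a b := by
  refine absolutelyContinuousOnInterval_of_dist_le
    (hf.norm.absolutelyContinuousOnInterval_intervalIntegral left_mem_uIcc) fun x hx y hy ↦ ?_
  have ha : a ∈ uIcc a b := left_mem_uIcc
  have h1 := intervalIntegrable_of_mem hf ha hx
  have h2 := intervalIntegrable_of_mem hf ha hy
  rw [dist_eq_norm, dist_eq_norm, intervalIntegral.integral_interval_sub_left h1 h2,
    intervalIntegral.integral_interval_sub_left h1.norm h2.norm]
  exact intervalIntegral.norm_integral_le_abs_integral_norm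

theorem absolutelyContinuousOnInterval_const {a b : ℝ} (c : ℂ) :
    AbsolutelyContinuousOnInterval (fun _ ↦ c) a b :=
  (contDiffOn_const (c := c)).absolutelyContinuousOnInterval

/-- The fundamental theorem of calculus for absolutely continuous complex-valued functions. -/
theorem eq_add_integral_of_ae_hasDerivAt {f g : ℝ → ℂ} {a b : ℝ}
    (hf : AbsolutelyContinuousOnInterval f a b) (hg : IntervalIntegrable g volume a b)
    (h : ∀ᵐ x, x ∈ uIcc a b → HasDerivAt f (g x) x) {t : ℝ} (ht : t ∈ uIcc a b) :
    f t = f a + ∫ v in a..t, g v := by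
  -- The difference of `f` and the primitive of `g` is absolutely continuous with derivative zero
  -- almost everywhere, hence constant.
  have hac := hf.sub (absolutelyContinuousOnInterval_integral hg)
  obtain ⟨C, hC⟩ := hac.const_of_ae_hasDerivAt_zero (by
    filter_upwards [h, hg.ae_hasDerivAt_integral] with x h1 h2 hx
    simpa using (h1 hx).sub (h2 hx a left_mem_uIcc))
  have h1 := hC a left_mem_uIcc
  have h2 := hC t ht
  simp only [Pi.sub_apply, intervalIntegral.integral_same, sub_zero] at h1 h2
  rw [h1, ← h2]; ring

theorem ae_hasDerivAt_add_integral {u : ℝ → ℂ} {a b : ℝ} (c : ℂ)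
    (hu : IntervalIntegrable u volume a b) :
    ∀ᵐ x, x ∈ uIcc a b → HasDerivAt (fun t ↦ c + ∫ v in a..t, u v) (u x) x := by
  filter_upwards [hu.ae_hasDerivAt_integral] with x hx hxI
  exact (hx hxI a left_mem_uIcc).const_add c

theorem absolutelyContinuousOnInterval_add_integral {u : ℝ → ℂ} {a b : ℝ} (c : ℂ)
    (hu : IntervalIntegrable u volume a b) :
    AbsolutelyContinuousOnInterval (fun t ↦ c + ∫ v in a..t, u v) a b :=
  (absolutelyContinuousOnInterval_const c).add (absolutelyContinuousOnInterval_integral hu)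

/-- The product rule, in integrated form. -/
theorem add_integral_mul_add_integral {u w : ℝ → ℂ} {a b : ℝ} (c d : ℂ)
    (hu : IntervalIntegrable u volume a b) (hw : IntervalIntegrable w volume a b)
    {t : ℝ} (ht : t ∈ uIcc a b) :
    (c + ∫ v in a..t, u v) * (d + ∫ v in a..t, w v) =
      c * d + ∫ s in a..t, (u s * (d + ∫ v in a..s, w v) + w s * (c + ∫ v in a..s, u v)) := by
  have hf := absolutelyContinuousOnInterval_add_integral c hu
  have hg := absolutelyContinuousOnInterval_add_integral d hw
  have hint : IntervalIntegrable (fun s ↦ u s * (d + ∫ v in a..s, w v) +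
      w s * (c + ∫ v in a..s, u v)) volume a b :=
    (hu.mul_continuousOn hg.continuousOn).add (hw.mul_continuousOn hf.continuousOn)
  have := eq_add_integral_of_ae_hasDerivAt (hf.smul hg) hint (by
    filter_upwards [ae_hasDerivAt_add_integral c hu, ae_hasDerivAt_add_integral d hw]
      with x h1 h2 hx
    have := (h1 hx).mul (h2 hx)
    rw [mul_comm (w x)]
    exact this) ht
  simpa using this

/-! ### Bounded operators on `L_p`: mean, multiplication, primitive. -/

section Lp

variable {p : ℝ≥0∞} [Fact (1 ≤ p)] {a b : ℝ}

/-- `L_p([a, b]; ℂ)`. -/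
abbrev LpI (p : ℝ≥0∞) (a b : ℝ) : Type := Lp ℂ p (volume.restrict (Icc a b))

theorem LpI.integrable (v : LpI p a b) : Integrable v (volume.restrict (Icc a b)) :=
  (Lp.memLp v).integrable Fact.out

theorem LpI.intervalIntegrable (hab : a ≤ b) (v : LpI p a b) :
    IntervalIntegrable v volume a b :=
  (intervalIntegrable_iff_integrableOn_Icc_of_le hab).2 v.integrable

/-- The norm bound of the inclusion of `L_p([a, b])` into `L_1([a, b])`. -/
noncomputable def toOneBound (p : ℝ≥0∞) (a b : ℝ) : ℝ :=
  (volume.restrict (Icc a b) univ ^ (1 / (1 : ℝ≥0∞).toReal - 1 / p.toReal)).toReal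

theorem toOneBound_nonneg (p : ℝ≥0∞) (a b : ℝ) : 0 ≤ toOneBound p a b := ENNReal.toReal_nonneg

theorem LpI.integral_norm_le (v : LpI p a b) :
    ∫ t, ‖v t‖ ∂(volume.restrict (Icc a b)) ≤
      toOneBound p a b * ‖v‖ := by
  have h1 : 1 ≤ p := Fact.out
  have hne : volume.restrict (Icc a b) univ ^ (1 / (1 : ℝ≥0∞).toReal - 1 / p.toReal) ≠ ∞ := by
    refine ENNReal.rpow_ne_top_of_nonneg ?_ (measure_ne_top _ _)
    -- For `p = ∞` the convention `1 / 0 = 0` gives the exponent its correct value `1`.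
    rcases eq_or_ne p ∞ with rfl | hp
    · simp
    · have := (ENNReal.toReal_le_toReal ENNReal.one_ne_top hp).2 h1
      simp only [ENNReal.toReal_one] at this ⊢
      rw [sub_nonneg, div_le_div_iff₀ (by linarith) one_pos]
      linarith
  have := eLpNorm_le_eLpNorm_mul_rpow_measure_univ h1 (Lp.aestronglyMeasurable v)
  rw [eLpNorm_one_eq_lintegral_enorm] at this
  rw [integral_norm_eq_lintegral_enorm (Lp.aestronglyMeasurable v), Lp.norm_def,
    toOneBound, ← ENNReal.toReal_mul, mul_comm]
  exact ENNReal.toReal_mono (ENNReal.mul_ne_top (Lp.eLpNorm_ne_top v) hne) this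

theorem norm_primitive_le {u : ℝ → ℂ}
    (hu : Integrable u (volume.restrict (Icc a b))) {t : ℝ} (ht : t ∈ Icc a b) :
    ‖∫ s in a..t, u s‖ ≤ ∫ s, ‖u s‖ ∂(volume.restrict (Icc a b)) := by
  rw [intervalIntegral.integral_of_le ht.1]
  refine (norm_integral_le_integral_norm _).trans ?_
  refine setIntegral_mono_set hu.norm (Eventually.of_forall fun _ ↦ norm_nonneg _) ?_
  exact (Ioc_subset_Icc_self.trans (Icc_subset_Icc_right ht.2)).eventuallyLE

theorem continuousOn_primitive (hab : a ≤ b) {u : ℝ → ℂ}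
    (hu : Integrable u (volume.restrict (Icc a b))) :
    ContinuousOn (fun t ↦ ∫ s in a..t, u s) (Icc a b) := by
  have := (absolutelyContinuousOnInterval_integral
    ((intervalIntegrable_iff_integrableOn_Icc_of_le hab).2 hu)).continuousOn
  rwa [uIcc_of_le hab] at this

theorem memLp_primitive (hab : a ≤ b) {u : ℝ → ℂ}
    (hu : Integrable u (volume.restrict (Icc a b))) :
    MemLp (fun t ↦ ∫ s in a..t, u s) ∞ (volume.restrict (Icc a b)) :=
  memLp_top_of_bound ((continuousOn_primitive hab hu).aestronglyMeasurable measurableSet_Icc) _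
    ((ae_restrict_iff' measurableSet_Icc).2
      (Eventually.of_forall fun _ ht ↦ norm_primitive_le hu ht))

theorem primitive_congr {u v : ℝ → ℂ} (h : u =ᵐ[volume.restrict (Icc a b)] v) {t : ℝ}
    (ht : t ∈ Icc a b) : ∫ s in a..t, u s = ∫ s in a..t, v s := by
  refine intervalIntegral.integral_congr_ae ?_
  rw [EventuallyEq, ae_restrict_iff' measurableSet_Icc] at h
  filter_upwards [h] with s hs hst
  rw [uIoc_of_le ht.1] at hst
  exact hs ⟨hst.1.le, hst.2.trans ht.2⟩

/-- The mean value over `[a, b]`. -/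
noncomputable def mean : LpI p a b →L[ℂ] ℂ :=
  LinearMap.mkContinuous
    { toFun := fun v ↦ ((b - a : ℝ) : ℂ)⁻¹ * ∫ t, v t ∂(volume.restrict (Icc a b))
      map_add' := fun u v ↦ by
        rw [integral_congr_ae (Lp.coeFn_add u v), ← mul_add]
        congr 1
        exact integral_add u.integrable v.integrable
      map_smul' := fun c v ↦ by
        rw [integral_congr_ae (Lp.coeFn_smul c v), RingHom.id_apply, smul_eq_mul, mul_left_comm]
        congr 1
        exact integral_smul c _ }
    (‖((b - a : ℝ) : ℂ)⁻¹‖ *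
      toOneBound p a b)
    fun v ↦ by
      rw [mul_assoc]
      refine (norm_mul_le _ _).trans (mul_le_mul_of_nonneg_left ?_ (norm_nonneg _))
      exact (norm_integral_le_integral_norm _).trans v.integral_norm_le

theorem mean_apply (v : LpI p a b) :
    mean v = ((b - a : ℝ) : ℂ)⁻¹ * ∫ t, v t ∂(volume.restrict (Icc a b)) := rfl

/-- Pointwise multiplication `L_p × L_∞ → L_p`. -/
noncomputable def mulTop : LpI p a b →L[ℂ] LpI ∞ a b →L[ℂ] LpI p a b :=
  (ContinuousLinearMap.mul ℂ ℂ).holderL (volume.restrict (Icc a b)) p ∞ p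

theorem coeFn_mulTop (u : LpI p a b) (v : LpI ∞ a b) :
    mulTop u v =ᵐ[volume.restrict (Icc a b)] fun t ↦ u t * v t :=
  ContinuousLinearMap.coeFn_holder (r := p) (ContinuousLinearMap.mul ℂ ℂ) u v

/-- The constant function `1`. -/
noncomputable def oneLp (p : ℝ≥0∞) (a b : ℝ) : LpI p a b := (memLp_const 1).toLp

theorem coeFn_oneLp : oneLp p a b =ᵐ[volume.restrict (Icc a b)] fun _ ↦ 1 :=
  MemLp.coeFn_toLp (memLp_const 1)

variable [Fact (a < b)]

/-- The primitive vanishing at `a`, as an operator from `L_p` to `L_∞`. -/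
noncomputable def primitiveTop : LpI p a b →L[ℂ] LpI ∞ a b :=
  have hab : a ≤ b := (Fact.out : a < b).le
  LinearMap.mkContinuous
    { toFun := fun v ↦ (memLp_primitive hab v.integrable).toLp
      map_add' := fun u v ↦ by
        rw [← MemLp.toLp_add]
        refine MemLp.toLp_congr _ _ ?_
        filter_upwards [ae_restrict_mem measurableSet_Icc] with t ht
        have htu : t ∈ uIcc a b := by rwa [uIcc_of_le hab]
        rw [primitive_congr (Lp.coeFn_add u v) ht]
        exact intervalIntegral.integral_add
          (intervalIntegrable_of_mem (u.intervalIntegrable hab) left_mem_uIcc htu)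
          (intervalIntegrable_of_mem (v.intervalIntegrable hab) left_mem_uIcc htu)
      map_smul' := fun c v ↦ by
        rw [RingHom.id_apply, ← MemLp.toLp_const_smul]
        refine MemLp.toLp_congr _ _ ?_
        filter_upwards [ae_restrict_mem measurableSet_Icc] with t ht
        rw [primitive_congr (Lp.coeFn_smul c v) ht]
        exact intervalIntegral.integral_smul c _ }
    (toOneBound p a b)
    fun v ↦ by
      rw [Lp.norm_def, ← ENNReal.toReal_ofReal
        (mul_nonneg (toOneBound_nonneg p a b) (norm_nonneg v)), eLpNorm_exponent_top]
      refine ENNReal.toReal_mono ENNReal.ofReal_ne_top (eLpNormEssSup_le_of_ae_bound ?_)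
      filter_upwards [MemLp.coeFn_toLp (memLp_primitive hab v.integrable),
        ae_restrict_mem measurableSet_Icc] with t h1 ht
      refine (congrArg norm h1).trans_le ?_
      exact (norm_primitive_le v.integrable ht).trans v.integral_norm_le

theorem coeFn_primitiveTop (v : LpI p a b) :
    primitiveTop v =ᵐ[volume.restrict (Icc a b)] fun t ↦ ∫ s in a..t, v s :=
  MemLp.coeFn_toLp (memLp_primitive (Fact.out : a < b).le v.integrable)

theorem mean_oneLp : mean (oneLp p a b) = 1 := by
  have hab : a < b := Fact.out
  rw [mean_apply, integral_congr_ae coeFn_oneLp]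
  have h : ((b - a : ℝ) : ℂ) ≠ 0 := by exact_mod_cast (sub_pos.2 hab).ne'
  simp [measureReal_def, hab.le]
  rw [← Complex.ofReal_sub]
  exact inv_mul_cancel₀ h

/-- The inclusion of `L_∞` into `L_p`. -/
noncomputable def ofTop : LpI ∞ a b →L[ℂ] LpI p a b := mulTop (oneLp p a b)

theorem coeFn_ofTop (v : LpI ∞ a b) :
    (ofTop v : LpI p a b) =ᵐ[volume.restrict (Icc a b)] v := by
  filter_upwards [coeFn_mulTop (oneLp p a b) v, coeFn_oneLp (p := p)] with t h1 h2
  refine h1.trans ?_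
  rw [h2, one_mul]

/-- The primitive vanishing at `a`, as an operator on `L_p`. -/
noncomputable def primitive : LpI p a b →L[ℂ] LpI p a b := ofTop.comp primitiveTop

theorem coeFn_primitive (v : LpI p a b) :
    primitive v =ᵐ[volume.restrict (Icc a b)] fun t ↦ ∫ s in a..t, v s :=
  (coeFn_ofTop _).trans (coeFn_primitiveTop v)

/-- If `u` is a constant plus the primitive of `v`, that constant. -/
noncomputable def initialValue (u v : LpI p a b) : ℂ := mean (u - primitive v)

/-- `u` is, up to a constant, the primitive of `v`. -/
def IsPrimitive (u v : LpI p a b) : Prop :=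
  u = initialValue u v • oneLp p a b + primitive v

/-- Point values make no sense in `L_p`. The mean is a bounded functional equal to `1` on the
constant `1`, so it recovers the constant once the primitive is subtracted. -/
theorem initialValue_add_primitive (c : ℂ) (v : LpI p a b) :
    initialValue (c • oneLp p a b + primitive v) v = c := by
  simp [initialValue, mean_oneLp]

theorem isPrimitive_add_primitive (c : ℂ) (v : LpI p a b) :
    IsPrimitive (c • oneLp p a b + primitive v) v := by
  rw [IsPrimitive, initialValue_add_primitive]

theorem coeFn_const_add_primitive (c : ℂ) (v : LpI p a b) :
    (c • oneLp p a b + primitive v : LpI p a b) =ᵐ[volume.restrict (Icc a b)]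
      fun t ↦ c + ∫ s in a..t, v s := by
  filter_upwards [Lp.coeFn_add (c • oneLp p a b) (primitive v), Lp.coeFn_smul c (oneLp p a b),
    coeFn_oneLp (p := p), coeFn_primitive v] with t h1 h2 h3 h4
  rw [h1, Pi.add_apply, h2, Pi.smul_apply, h3, h4, smul_eq_mul, mul_one]

theorem isPrimitive_of_ae {u v : LpI p a b} {c : ℂ}
    (h : u =ᵐ[volume.restrict (Icc a b)] fun t ↦ c + ∫ s in a..t, v s) :
    u = c • oneLp p a b + primitive v :=
  Lp.ext (h.trans (coeFn_const_add_primitive c v).symm)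

end Lp

end

/-! ### Sobolev functions as chains of primitives; completeness. -/

section

variable {p : ℝ≥0∞} [Fact (1 ≤ p)] {a b : ℝ} [Fact (a < b)]

/-- The endpoints form a null set, and at interior points the one-sided and two-sided derivatives
coincide. -/
theorem ae_hasDerivAt_derivWithin_Icc {f : ℝ → ℂ} {a b : ℝ} (hab : a < b)
    (hf : AbsolutelyContinuousOnInterval f a b) :
    ∀ᵐ t, t ∈ uIcc a b → HasDerivAt f (derivWithin f (Icc a b) t) t := by
  have h := hf.boundedVariationOn.ae_differentiableAt_of_mem_uIcc
  have hae : ∀ᵐ t : ℝ, t ≠ a ∧ t ≠ b :=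
    (Measure.ae_ne volume a).and (Measure.ae_ne volume b)
  filter_upwards [h, hae] with t ht hne htI
  have hd := ht htI
  rw [uIcc_of_le hab.le] at htI
  have hn : Icc a b ∈ 𝓝 t :=
    Icc_mem_nhds (lt_of_le_of_ne htI.1 hne.1.symm) (lt_of_le_of_ne htI.2 hne.2)
  rw [derivWithin_of_mem_nhds hn]
  exact hd.hasDerivAt

/-- The definition gives this at order `k` only; derivatives of lower order are `C^1` on a compact
interval. -/
theorem IsSobolevFun.absolutelyContinuous {k : ℕ} {y : ℝ → ℂ}
    (hy : IsSobolevFun p a b (k + 1) y) {s : ℕ} (hs : s ≤ k) :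
    AbsolutelyContinuousOnInterval (iteratedDerivWithin s y (Icc a b)) a b := by
  have hab : a < b := Fact.out
  rcases hs.eq_or_lt with rfl | h
  · exact hy.2.1
  · have hU := uniqueDiffOn_Icc hab
    have : ContDiffOn ℝ 1 (iteratedDerivWithin s y (Icc a b)) (uIcc a b) := by
      rw [uIcc_of_le hab.le]
      have hle : ((s + 1 : ℕ) : WithTop ℕ∞) ≤ ((k : ℕ) : WithTop ℕ∞) := by exact_mod_cast h
      exact ((contDiffOn_nat_succ_iff_contDiffOn_one_iteratedDerivWithin hU).1
        (by simpa using hy.1.of_le hle)).2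
    exact this.absolutelyContinuousOnInterval

theorem IsSobolevFun.eq_add_integral {k : ℕ} {y : ℝ → ℂ}
    (hy : IsSobolevFun p a b (k + 1) y) {s : ℕ} (hs : s ≤ k)
    (hint : IntervalIntegrable (iteratedDerivWithin (s + 1) y (Icc a b)) volume a b)
    {t : ℝ} (ht : t ∈ Icc a b) :
    iteratedDerivWithin s y (Icc a b) t = iteratedDerivWithin s y (Icc a b) a +
      ∫ v in a..t, iteratedDerivWithin (s + 1) y (Icc a b) v := by
  have hab : a < b := Fact.out
  have hac := hy.absolutelyContinuous hs
  refine eq_add_integral_of_ae_hasDerivAt hac hint ?_ (by rwa [uIcc_of_le hab.le])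
  filter_upwards [ae_hasDerivAt_derivWithin_Icc hab hac] with x hx hxI
  rw [iteratedDerivWithin_succ]
  exact hx hxI

theorem IsSobolevFun.isPrimitive {k : ℕ} {y : ℝ → ℂ} (hy : IsSobolevFun p a b (k + 1) y)
    {s : ℕ} (hs : s ≤ k) {u v : LpI p a b}
    (hu : u =ᵐ[volume.restrict (Icc a b)] iteratedDerivWithin s y (Icc a b))
    (hv : v =ᵐ[volume.restrict (Icc a b)] iteratedDerivWithin (s + 1) y (Icc a b)) :
    u = iteratedDerivWithin s y (Icc a b) a • oneLp p a b + primitive v := by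
  have hab : a < b := Fact.out
  have hint : IntervalIntegrable (iteratedDerivWithin (s + 1) y (Icc a b)) volume a b := by
    rw [intervalIntegrable_iff_integrableOn_Icc_of_le hab.le]
    exact v.integrable.congr hv
  refine isPrimitive_of_ae ?_
  filter_upwards [hu, ae_restrict_mem measurableSet_Icc] with t h1 ht
  rw [h1, hy.eq_add_integral hs hint ht, primitive_congr hv ht]

theorem derivWithin_add_integral_of_continuousOn {z : ℝ → ℂ} (c : ℂ)
    (hz : ContinuousOn z (Icc a b)) {t : ℝ} (ht : t ∈ Icc a b) :
    HasDerivWithinAt (fun t ↦ c + ∫ s in a..t, z s) (z t) (Icc a b) t := by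
  have hab : a < b := Fact.out
  have : Fact (t ∈ Icc a b) := ⟨ht⟩
  have hi : IntervalIntegrable z volume a t :=
    ContinuousOn.intervalIntegrable_of_Icc ht.1 (hz.mono (Icc_subset_Icc_right ht.2))
  have hm : StronglyMeasurableAtFilter z (𝓝[Icc a b] t) volume :=
    ⟨Icc a b, self_mem_nhdsWithin, hz.aestronglyMeasurable measurableSet_Icc⟩
  exact (intervalIntegral.integral_hasDerivWithinAt_right hi hm (hz t ht)).const_add c

/-- For `k = 0` the derivative of the primitive is `z` only almost everywhere. For `k ≥ 1` the
function `z` is continuous, so this holds at every point of `[a, b]`, and all higher derivatives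
shift by one order. -/
theorem IsSobolevFun.exists_primitive {k : ℕ} {z : ℝ → ℂ} (hz : IsSobolevFun p a b k z) (c : ℂ) :
    IsSobolevFun p a b (k + 1) (fun t ↦ c + ∫ s in a..t, z s) ∧
    ∀ s, s ≤ k → iteratedDerivWithin (s + 1) (fun t ↦ c + ∫ s in a..t, z s) (Icc a b)
      =ᵐ[volume.restrict (Icc a b)] iteratedDerivWithin s z (Icc a b) := by
  have hab : a < b := Fact.out
  have hU := uniqueDiffOn_Icc hab
  set y : ℝ → ℂ := fun t ↦ c + ∫ s in a..t, z s with hydef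
  cases k with
  | zero =>
    have hzi : IntervalIntegrable z volume a b := by
      rw [intervalIntegrable_iff_integrableOn_Icc_of_le hab.le]
      exact MemLp.integrable Fact.out hz
    have hac : AbsolutelyContinuousOnInterval y a b :=
      absolutelyContinuousOnInterval_add_integral c hzi
    have hder : iteratedDerivWithin 1 y (Icc a b) =ᵐ[volume.restrict (Icc a b)] z := by
      rw [EventuallyEq, ae_restrict_iff' measurableSet_Icc]
      filter_upwards [ae_hasDerivAt_add_integral c hzi, ae_hasDerivAt_derivWithin_Icc hab hac]
        with t h1 h2 ht
      rw [← uIcc_of_le hab.le] at ht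
      rw [iteratedDerivWithin_one]
      exact (h2 ht).unique (h1 ht)
    refine ⟨⟨?_, by simpa using hac, (memLp_congr_ae hder).2 hz⟩, fun s hs ↦ ?_⟩
    · have := hac.continuousOn
      rw [uIcc_of_le hab.le] at this
      simpa [contDiffOn_zero] using this
    · obtain rfl : s = 0 := by omega
      simpa using hder
  | succ k =>
    have hd : ∀ t ∈ Icc a b, HasDerivWithinAt y (z t) (Icc a b) t := fun t ht ↦
      derivWithin_add_integral_of_continuousOn c hz.1.continuousOn ht
    have hdw : EqOn (derivWithin y (Icc a b)) z (Icc a b) := fun t ht ↦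
      (hd t ht).derivWithin (hU t ht)
    have key : ∀ s, EqOn (iteratedDerivWithin (s + 1) y (Icc a b))
        (iteratedDerivWithin s z (Icc a b)) (Icc a b) := fun s t ht ↦ by
      rw [iteratedDerivWithin_succ']
      exact iteratedDerivWithin_congr hdw ht
    have keyae : ∀ s, iteratedDerivWithin (s + 1) y (Icc a b)
        =ᵐ[volume.restrict (Icc a b)] iteratedDerivWithin s z (Icc a b) := fun s ↦ by
      filter_upwards [ae_restrict_mem measurableSet_Icc] with t ht using key s ht
    refine ⟨⟨?_, ?_, ?_⟩, fun s _ ↦ keyae s⟩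
    · push_cast
      rw [contDiffOn_succ_iff_derivWithin hU]
      exact ⟨fun t ht ↦ (hd t ht).differentiableWithinAt, by simp, hz.1.congr hdw⟩
    · exact absolutelyContinuousOnInterval_congr hab hz.2.1 (key k).symm
    · exact (memLp_congr_ae (keyae (k + 1))).2 hz.2.2

theorem exists_isSobolevFun : ∀ (k : ℕ) (u : Fin (k + 1) → LpI p a b),
    (∀ s : Fin k, IsPrimitive (u s.castSucc) (u s.succ)) →
    ∃ y, IsSobolevFun p a b k y ∧ ∀ s : Fin (k + 1),
      u s =ᵐ[volume.restrict (Icc a b)] iteratedDerivWithin (s : ℕ) y (Icc a b) := by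
  intro k
  induction k with
  | zero =>
    intro u _
    refine ⟨u 0, Lp.memLp (u 0), fun s ↦ ?_⟩
    obtain rfl : s = 0 := Fin.fin_one_eq_zero s
    simp
  | succ k ih =>
    intro u hu
    -- The tail of the chain is represented by some `z`; integrating `z` with the constant read off
    -- from `u 0` and `u 1` represents the whole chain.
    obtain ⟨z, hz, huz⟩ := ih (fun s ↦ u s.succ) fun s ↦ hu s.succ
    obtain ⟨h1, h2⟩ := hz.exists_primitive (initialValue (u 0) (u 1))
    refine ⟨_, h1, fun s ↦ ?_⟩
    induction s using Fin.cases with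
    | zero =>
      have h0 : u 0 = initialValue (u 0) (u 1) • oneLp p a b + primitive (u 1) := hu 0
      have h3 := coeFn_const_add_primitive (initialValue (u 0) (u 1)) (u 1)
      rw [← h0] at h3
      have hz1 := huz 0
      filter_upwards [h3, ae_restrict_mem measurableSet_Icc] with t h4 ht
      rw [h4]
      simp only [Fin.succ_zero_eq_one, Fin.val_zero, iteratedDerivWithin_zero] at hz1 ⊢
      rw [primitive_congr hz1 ht]
    | succ s => exact (huz s).trans (h2 s (Nat.lt_succ_iff.1 s.2)).symm

/-- Replaces pointwise derivatives by `k` linear conditions between `L_p` classes. They are closed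
conditions, and they are easy to check when an operator into `W^k_p` is built. -/
theorem mem_sobolevSubmodule_iff {k : ℕ}
    {u : PiLp 1 fun _ : Fin (k + 1) ↦ LpI p a b} :
    u ∈ sobolevSubmodule k p a b ↔ ∀ s : Fin k, IsPrimitive (u s.castSucc) (u s.succ) := by
  constructor
  · rintro ⟨y, hy, hu⟩ s
    cases k with
    | zero => exact s.elim0
    | succ k =>
      have := hy.isPrimitive (Nat.lt_succ_iff.1 s.2) (hu s.castSucc) (hu s.succ)
      rw [this]
      exact isPrimitive_add_primitive _ _
  · exact fun h ↦ exists_isSobolevFun k u h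

theorem Sobolev.isPrimitive {k : ℕ} (u : Sobolev k p a b) (s : Fin k) :
    IsPrimitive (u.1 s.castSucc) (u.1 s.succ) :=
  mem_sobolevSubmodule_iff.1 u.2 s

theorem isClosed_sobolevSubmodule (k : ℕ) :
    IsClosed (sobolevSubmodule k p a b : Set (PiLp 1 fun _ : Fin (k + 1) ↦ LpI p a b)) := by
  have : (sobolevSubmodule k p a b : Set (PiLp 1 fun _ : Fin (k + 1) ↦ LpI p a b)) =
      ⋂ s : Fin k, {u | IsPrimitive (u s.castSucc) (u s.succ)} := by
    ext u
    simp [mem_sobolevSubmodule_iff]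
  rw [this]
  refine isClosed_iInter fun s ↦ ?_
  have h (i : Fin (k + 1)) :
      Continuous fun u : PiLp 1 fun _ : Fin (k + 1) ↦ LpI p a b ↦ u i :=
    PiLp.continuous_apply _ _ i
  refine isClosed_eq (h _) ?_
  unfold initialValue
  have h1 := h s.castSucc
  have h2 := h s.succ
  fun_prop

instance (k : ℕ) : CompleteSpace (Sobolev k p a b) :=
  (isClosed_sobolevSubmodule k).completeSpace_coe

/-- For `k ≥ 1`, continuous representatives that agree almost everywhere agree on `[a, b]`, and so
do their derivatives. Identities in `W^k_p` thus need checking only in `L_p`. -/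
theorem Sobolev.ext_zero {k : ℕ} {u v : Sobolev k p a b} (h : u.1 0 = v.1 0) : u = v := by
  have hab : a < b := Fact.out
  obtain ⟨hu, hus⟩ := u.toFun_spec
  obtain ⟨hv, hvs⟩ := v.toFun_spec
  refine Subtype.ext (PiLp.ext fun s ↦ ?_)
  cases k with
  | zero =>
    obtain rfl : s = 0 := Fin.fin_one_eq_zero s
    exact h
  | succ k =>
    have h0 : u.toFun =ᵐ[volume.restrict (Icc a b)] v.toFun := by
      have h1 := (hus 0).symm.trans ((Eq.eventuallyEq (congrArg (fun w : LpI p a b ↦ (w : ℝ → ℂ)) h)).trans (hvs 0))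
      simpa using h1
    have heq := Measure.eqOn_Icc_of_ae_eq volume hab.ne h0 hu.1.continuousOn hv.1.continuousOn
    refine Lp.ext ((hus s).trans (EventuallyEq.trans ?_ (hvs s).symm))
    filter_upwards [ae_restrict_mem measurableSet_Icc] with t ht
    exact iteratedDerivWithin_congr heq ht

end

/-! ### The normed-space structure of `W^k_p`, as named instances. -/

section

variable (p : ℝ≥0∞) [Fact (1 ≤ p)] (a b : ℝ) [Fact (a < b)] (k : ℕ)

noncomputable abbrev Sobolev.normedAddCommGroup :
    NormedAddCommGroup (Sobolev k p a b) := inferInstance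

noncomputable abbrev Sobolev.seminormedAddCommGroup :
    SeminormedAddCommGroup (Sobolev k p a b) := inferInstance

noncomputable abbrev Sobolev.addCommGroup :
    AddCommGroup (Sobolev k p a b) := inferInstance

noncomputable abbrev Sobolev.addCommMonoid :
    AddCommMonoid (Sobolev k p a b) := inferInstance

noncomputable abbrev Sobolev.normedSpace :
    NormedSpace ℂ (Sobolev k p a b) := inferInstance

noncomputable abbrev Sobolev.module :
    Module ℂ (Sobolev k p a b) := inferInstance

noncomputable abbrev Sobolev.mulAction :
    MulAction ℂ (Sobolev k p a b) := inferInstance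

noncomputable abbrev Sobolev.topologicalSpace :
    TopologicalSpace (Sobolev k p a b) := inferInstance

theorem Sobolev.continuousSMul :
    ContinuousSMul ℂ (Sobolev k p a b) := inferInstance

theorem Sobolev.isTopologicalAddGroup :
    IsTopologicalAddGroup (Sobolev k p a b) := inferInstance

end

attribute [local instance] Sobolev.normedAddCommGroup
  Sobolev.seminormedAddCommGroup
  Sobolev.addCommGroup
  Sobolev.addCommMonoid
  Sobolev.normedSpace
  Sobolev.module
  Sobolev.mulAction
  Sobolev.topologicalSpace
  Sobolev.continuousSMul
  Sobolev.isTopologicalAddGroup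

/-! ### Derivation, integration and multiplication as bounded operators between Sobolev spaces. -/

section

variable {p : ℝ≥0∞} [Fact (1 ≤ p)] {a b : ℝ} [Fact (a < b)]

section Bilinear

variable {E F G H : Type*} [NormedAddCommGroup E] [NormedSpace ℂ E]
  [NormedAddCommGroup F] [NormedSpace ℂ F] [NormedAddCommGroup G] [NormedSpace ℂ G]
  [NormedAddCommGroup H] [NormedSpace ℂ H]

/-- The bilinear operator `(u, v) ↦ J (T (D u) v + T (D v) u, φ u * φ v)`. -/
noncomputable def leibniz (J : F × ℂ →L[ℂ] G) (T : F →L[ℂ] E →L[ℂ] F) (D : E →L[ℂ] F)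
    (φ : E →L[ℂ] ℂ) : E →L[ℂ] E →L[ℂ] G :=
  (ContinuousLinearMap.compL ℂ E F G (J.comp (ContinuousLinearMap.inl ℂ F ℂ))).comp
    (T.comp D + (T.comp D).flip) +
  (ContinuousLinearMap.compL ℂ E ℂ G (J.comp (ContinuousLinearMap.inr ℂ F ℂ))).comp
    ((ContinuousLinearMap.mul ℂ ℂ).bilinearComp φ φ)

theorem leibniz_apply (J : F × ℂ →L[ℂ] G) (T : F →L[ℂ] E →L[ℂ] F) (D : E →L[ℂ] F)
    (φ : E →L[ℂ] ℂ) (u v : E) :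
    leibniz J T D φ u v = J (T (D u) v + T (D v) u, φ u * φ v) := by
  have h : leibniz J T D φ u v = J (T (D u) v + T (D v) u, 0) + J (0, φ u * φ v) := rfl
  rw [h, ← map_add]
  simp

/-- A bilinear operator, precomposed with two operators and postcomposed with one. -/
noncomputable def conjBilin (J : G →L[ℂ] H) (T : E →L[ℂ] F →L[ℂ] G) {E' F' : Type*}
    [NormedAddCommGroup E'] [NormedSpace ℂ E'] [NormedAddCommGroup F'] [NormedSpace ℂ F']
    (D : E' →L[ℂ] E) (D' : F' →L[ℂ] F) : E' →L[ℂ] F' →L[ℂ] H :=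
  (ContinuousLinearMap.compL ℂ F' G H J).comp (T.bilinearComp D D')

end Bilinear

namespace Sobolev

/-- The derivative of order `s`, as an element of `L_p`. -/
noncomputable def derivLp {k : ℕ} (s : Fin (k + 1)) : Sobolev k p a b →L[ℂ] LpI p a b :=
  (PiLp.proj 1 (fun _ : Fin (k + 1) ↦ LpI p a b) s).comp (sobolevSubmodule k p a b).subtypeL

/-- Operators into the Sobolev space, given by the derivatives of their values. -/
noncomputable def lift {E : Type*} [NormedAddCommGroup E] [NormedSpace ℂ E] {k : ℕ}
    (T : Fin (k + 1) → E →L[ℂ] LpI p a b)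
    (h : ∀ (s : Fin k) x, IsPrimitive (T s.castSucc x) (T s.succ x)) :
    E →L[ℂ] Sobolev k p a b :=
  (((PiLp.continuousLinearEquiv 1 ℂ fun _ : Fin (k + 1) ↦ LpI p a b).symm :
    (Fin (k + 1) → LpI p a b) →L[ℂ] _).comp (ContinuousLinearMap.pi T)).codRestrict
    (sobolevSubmodule k p a b) fun x ↦ mem_sobolevSubmodule_iff.2 (by exact fun s ↦ h s x)

/-- The derivative of order `s`, as an operator from `W^k_p` to `W^l_p` for `s + l ≤ k`. -/
noncomputable def derivCLM (s : ℕ) {k l : ℕ} (h : s + l ≤ k) :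
    Sobolev k p a b →L[ℂ] Sobolev l p a b :=
  lift (fun i ↦ derivLp ⟨s + i, by omega⟩) fun i u ↦ u.isPrimitive ⟨s + i, by omega⟩

/-- The primitive of an element of `W^k_p` with a given initial value. -/
noncomputable def integrate {k : ℕ} : Sobolev k p a b × ℂ →L[ℂ] Sobolev (k + 1) p a b :=
  lift (Fin.cases
    ((ContinuousLinearMap.snd ℂ (Sobolev k p a b) ℂ).smulRight (oneLp p a b) +
      (primitive.comp (derivLp 0)).comp (ContinuousLinearMap.fst ℂ _ ℂ))
    fun i ↦ (derivLp i).comp (ContinuousLinearMap.fst ℂ _ ℂ))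
    (by
      intro s x
      induction s using Fin.cases with
      | zero => exact isPrimitive_add_primitive _ _
      | succ s => exact x.1.isPrimitive s)

theorem integrate_apply_zero {k : ℕ} (x : Sobolev k p a b × ℂ) :
    (integrate x).1 0 = x.2 • oneLp p a b + primitive (x.1.1 0) := rfl

/-- `W^0_p` is `L_p`. -/
noncomputable def ofLp : LpI p a b →L[ℂ] Sobolev 0 p a b :=
  lift (fun _ ↦ ContinuousLinearMap.id ℂ _) fun s ↦ s.elim0

/-- The value at `a` of the derivative of order `s`. -/
noncomputable def initial {k : ℕ} (s : Fin k) : Sobolev k p a b →L[ℂ] ℂ :=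
  mean.comp (derivLp s.castSucc - primitive.comp (derivLp s.succ))

theorem eq_initial_add {k : ℕ} (s : Fin k) (u : Sobolev k p a b) :
    u.1 s.castSucc = initial s u • oneLp p a b + primitive (u.1 s.succ) :=
  u.isPrimitive s

theorem ae_eq_initial_add {k : ℕ} (s : Fin k) (u : Sobolev k p a b) :
    u.1 s.castSucc =ᵐ[volume.restrict (Icc a b)]
      fun t ↦ initial s u + ∫ v in a..t, u.1 s.succ v := by
  rw [eq_initial_add]
  exact coeFn_const_add_primitive _ _

theorem initial_integrate_zero {k : ℕ} (x : Sobolev k p a b × ℂ) :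
    initial 0 (integrate x) = x.2 :=
  initialValue_add_primitive _ _

/-- The bounded representative of an element of `W^1_p`. -/
noncomputable def toTop : Sobolev 1 p a b →L[ℂ] LpI ∞ a b :=
  (initial 0).smulRight (oneLp ∞ a b) + primitiveTop.comp (derivLp 1)

theorem coeFn_toTop (u : Sobolev 1 p a b) : toTop u =ᵐ[volume.restrict (Icc a b)] u.1 0 := by
  refine EventuallyEq.trans ?_ (ae_eq_initial_add 0 u).symm
  have h : toTop u = initial 0 u • oneLp ∞ a b + primitiveTop (u.1 1) := rfl
  rw [h]
  filter_upwards [Lp.coeFn_add (initial 0 u • oneLp ∞ a b) (primitiveTop (u.1 1)),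
    Lp.coeFn_smul (initial 0 u) (oneLp ∞ a b), coeFn_oneLp (p := ∞), coeFn_primitiveTop (u.1 1)]
    with t h1 h2 h3 h4
  rw [h1, Pi.add_apply, h2, Pi.smul_apply, h3, h4, smul_eq_mul, mul_one]
  rfl

/-- The product of two functions of class `W^{n+1}_p`, given the product
`W^n_p × W^{n+1}_p → W^n_p`. -/
noncomputable def mulSucc {n : ℕ}
    (T : Sobolev n p a b →L[ℂ] Sobolev (n + 1) p a b →L[ℂ] Sobolev n p a b) :
    Sobolev (n + 1) p a b →L[ℂ] Sobolev (n + 1) p a b →L[ℂ] Sobolev (n + 1) p a b :=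
  leibniz integrate T (derivCLM 1 (by omega)) (initial 0)

theorem mulSucc_apply {n : ℕ}
    (T : Sobolev n p a b →L[ℂ] Sobolev (n + 1) p a b →L[ℂ] Sobolev n p a b)
    (u v : Sobolev (n + 1) p a b) :
    mulSucc T u v = integrate (T (derivCLM 1 (by omega) u) v + T (derivCLM 1 (by omega) v) u,
      initial 0 u * initial 0 v) :=
  leibniz_apply _ _ _ _ _ _

theorem coeFn_mulSucc {n : ℕ}
    {T : Sobolev n p a b →L[ℂ] Sobolev (n + 1) p a b →L[ℂ] Sobolev n p a b}
    (hT : ∀ u v, (T u v).1 0 =ᵐ[volume.restrict (Icc a b)] fun t ↦ u.1 0 t * v.1 0 t)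
    (u v : Sobolev (n + 1) p a b) :
    (mulSucc T u v).1 0 =ᵐ[volume.restrict (Icc a b)] fun t ↦ u.1 0 t * v.1 0 t := by
  have hab : a < b := Fact.out
  have hu0 := ae_eq_initial_add 0 u
  have hv0 := ae_eq_initial_add 0 v
  simp only [Fin.castSucc_zero, Fin.succ_zero_eq_one] at hu0 hv0
  rw [mulSucc_apply, integrate_apply_zero]
  refine (coeFn_const_add_primitive _ _).trans ?_
  -- Writing `u` and `v` as constants plus integrals puts `u'v + v'u` in the form required by the
  -- integrated product rule.
  have key : (T (derivCLM 1 (by omega) u) v + T (derivCLM 1 (by omega) v) u).1 0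
      =ᵐ[volume.restrict (Icc a b)] fun s ↦
        u.1 1 s * (initial 0 v + ∫ r in a..s, v.1 1 r) +
        v.1 1 s * (initial 0 u + ∫ r in a..s, u.1 1 r) := by
    refine (Lp.coeFn_add _ _).trans ?_
    filter_upwards [hT (derivCLM 1 (by omega) u) v, hT (derivCLM 1 (by omega) v) u, hu0, hv0]
      with t h1 h2 h3 h4
    refine (congrArg₂ (· + ·) h1 h2).trans ?_
    rw [h3, h4]
    rfl
  filter_upwards [hu0, hv0, ae_restrict_mem measurableSet_Icc] with t h1 h2 ht
  rw [h1, h2, primitive_congr key ht, add_integral_mul_add_integral _ _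
    (LpI.intervalIntegrable hab.le (u.1 1)) (LpI.intervalIntegrable hab.le (v.1 1))
    (by rwa [uIcc_of_le hab.le])]

/-- The product `W^n_p × W^{n+1}_p → W^n_p`. -/
noncomputable def mul :
    (n : ℕ) → Sobolev n p a b →L[ℂ] Sobolev (n + 1) p a b →L[ℂ] Sobolev n p a b
  -- `L_p` is not closed under products in general, so the second factor is taken one order
  -- smoother: `W^1_p` embeds in `L_∞`. This fits the system, where `y^{(l)}` with `l < r` lies in
  -- `W^{n+1}_p`.
  | 0 => conjBilin ofLp mulTop (derivLp 0) toTop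
  -- `derivCLM 0` is the inclusion of `W^{n+2}_p` into `W^{n+1}_p`.
  | n + 1 => (mulSucc (mul n)).bilinearComp (ContinuousLinearMap.id ℂ _) (derivCLM 0 (by omega))

theorem coeFn_mul (n : ℕ) (u : Sobolev n p a b) (v : Sobolev (n + 1) p a b) :
    (mul n u v).1 0 =ᵐ[volume.restrict (Icc a b)] fun t ↦ u.1 0 t * v.1 0 t := by
  induction n with
  | zero =>
    have h : (mul 0 u v).1 0 = mulTop (u.1 0) (toTop v) := rfl
    rw [h]
    filter_upwards [coeFn_mulTop (u.1 0) (toTop v), coeFn_toTop v] with t h1 h2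
    rw [h1, h2]
  | succ n ih => exact coeFn_mulSucc ih u (derivCLM 0 (by omega) v)

end Sobolev

end

/-! ### Volterra equations of the second kind in `L_p`. -/

section

theorem absolutelyContinuousOnInterval_pow {G : ℝ → ℝ} {a b : ℝ}
    (hG : AbsolutelyContinuousOnInterval G a b) (k : ℕ) :
    AbsolutelyContinuousOnInterval (fun t ↦ G t ^ k) a b := by
  induction k with
  | zero => simpa using (contDiffOn_const (c := (1 : ℝ))).absolutelyContinuousOnInterval
  | succ k ih => simpa only [pow_succ] using ih.fun_mul hG

/-- If `G` is the primitive of `g`, then `G^(k+1)` is absolutely continuous with derivative `(k+1) g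
G^k` almost everywhere. -/
theorem integral_mul_primitive_pow {g : ℝ → ℝ} {a b : ℝ} (hg : IntervalIntegrable g volume a b)
    (k : ℕ) {t : ℝ} (ht : t ∈ uIcc a b) :
    ∫ s in a..t, g s * (∫ r in a..s, g r) ^ k = (∫ r in a..t, g r) ^ (k + 1) / (k + 1) := by
  have hsub : uIcc a t ⊆ uIcc a b := uIcc_subset_uIcc left_mem_uIcc ht
  have hgt : IntervalIntegrable g volume a t := hg.mono_set hsub
  have hac := absolutelyContinuousOnInterval_pow
    (hgt.absolutelyContinuousOnInterval_intervalIntegral left_mem_uIcc) (k + 1)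
  have h := hac.integral_deriv_eq_sub
  simp only [intervalIntegral.integral_same, ne_eq, Nat.add_eq_zero_iff, one_ne_zero, and_false,
    not_false_eq_true, zero_pow, sub_zero] at h
  rw [← h, eq_div_iff (by positivity), ← intervalIntegral.integral_mul_const]
  refine intervalIntegral.integral_congr_ae ?_
  filter_upwards [hgt.ae_hasDerivAt_integral] with s hs hst
  have hd := (hs (uIoc_subset_uIcc hst) a left_mem_uIcc).fun_pow (k + 1)
  rw [hd.deriv]
  push_cast [Nat.add_sub_cancel]
  ring

section

variable {p : ℝ≥0∞} [Fact (1 ≤ p)] {a b : ℝ} [Fact (a < b)] {m : ℕ}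

/-- The sum of the absolute values of the components. -/
noncomputable def absSum (v : Fin m → LpI p a b) (t : ℝ) : ℝ := ∑ i, ‖v i t‖

theorem absSum_nonneg (v : Fin m → LpI p a b) (t : ℝ) : 0 ≤ absSum v t :=
  Finset.sum_nonneg fun _ _ ↦ norm_nonneg _

theorem integrable_absSum (v : Fin m → LpI p a b) :
    Integrable (absSum v) (volume.restrict (Icc a b)) :=
  integrable_finsetSum _ fun i _ ↦ (LpI.integrable (v i)).norm

theorem intervalIntegrable_of_integrable {f : ℝ → ℝ}
    (hf : Integrable f (volume.restrict (Icc a b))) {t : ℝ} (ht : t ∈ Icc a b) :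
    IntervalIntegrable f volume a t := by
  rw [intervalIntegrable_iff_integrableOn_Icc_of_le ht.1]
  exact IntegrableOn.mono_set hf (Icc_subset_Icc_right ht.2)

theorem integral_mono_of_ae {f g : ℝ → ℝ} (hf : Integrable f (volume.restrict (Icc a b)))
    (hg : Integrable g (volume.restrict (Icc a b)))
    (h : ∀ᵐ t ∂(volume.restrict (Icc a b)), f t ≤ g t) {t : ℝ} (ht : t ∈ Icc a b) :
    ∫ s in a..t, f s ≤ ∫ s in a..t, g s := by
  refine intervalIntegral.integral_mono_ae_restrict ht.1 (intervalIntegrable_of_integrable hf ht)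
    (intervalIntegrable_of_integrable hg ht) ?_
  exact ae_mono (Measure.restrict_mono (Icc_subset_Icc_right ht.2) le_rfl) h

theorem integral_mono_right {f : ℝ → ℝ} (hf : Integrable f (volume.restrict (Icc a b)))
    (h0 : ∀ t, 0 ≤ f t) {s t : ℝ} (hs : a ≤ s) (hst : s ≤ t) (ht : t ≤ b) :
    ∫ r in a..s, f r ≤ ∫ r in a..t, f r :=
  intervalIntegral.integral_mono_interval le_rfl hs hst (Eventually.of_forall h0)
    (intervalIntegrable_of_integrable hf ⟨hs.trans hst, ht⟩)

/-- The iterates of a Volterra operator decay factorially. -/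
theorem volterra_pow_bound (K : (Fin m → LpI p a b) →L[ℂ] (Fin m → LpI p a b)) {g : ℝ → ℝ}
    (hg : Integrable g (volume.restrict (Icc a b))) (hg0 : ∀ t, 0 ≤ g t)
    (hK : ∀ v, ∀ᵐ t ∂(volume.restrict (Icc a b)),
      absSum (K v) t ≤ g t * ∫ s in a..t, absSum v s) (k : ℕ) (v : Fin m → LpI p a b) :
    ∀ᵐ t ∂(volume.restrict (Icc a b)), absSum ((K ^ (k + 1)) v) t ≤
      g t * ((∫ s in a..t, g s) ^ k / k.factorial * ∫ s in a..b, absSum v s) := by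
  have hab : a < b := Fact.out
  have hgi : IntervalIntegrable g volume a b :=
    intervalIntegrable_of_integrable hg (right_mem_Icc.2 hab.le)
  induction k with
  | zero =>
    filter_upwards [hK v, ae_restrict_mem measurableSet_Icc] with t h1 ht
    simp only [zero_add, pow_one, pow_zero, Nat.factorial_zero, Nat.cast_one, div_one, one_mul]
    refine h1.trans (mul_le_mul_of_nonneg_left ?_ (hg0 t))
    exact integral_mono_right (integrable_absSum v) (absSum_nonneg v) ht.1 ht.2 le_rfl
  | succ k ih =>
    set C := ∫ s in a..b, absSum v s
    have hGc : ContinuousOn (fun t ↦ (∫ s in a..t, g s) ^ k / k.factorial * C) (uIcc a b) :=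
      (((absolutelyContinuousOnInterval_pow
        (hgi.absolutelyContinuousOnInterval_intervalIntegral left_mem_uIcc) k).continuousOn).div_const
          _).mul_const _
    have hri : Integrable (fun t ↦ g t * ((∫ s in a..t, g s) ^ k / k.factorial * C))
        (volume.restrict (Icc a b)) :=
      (intervalIntegrable_iff_integrableOn_Icc_of_le hab.le).1 (hgi.mul_continuousOn hGc)
    rw [pow_succ' K (k + 1)]
    filter_upwards [hK ((K ^ (k + 1)) v), ae_restrict_mem measurableSet_Icc] with t h1 ht
    refine h1.trans (mul_le_mul_of_nonneg_left ?_ (hg0 t))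
    -- The inductive bound goes under the integral, where integrating `g G^k` yields `G^(k+1) /
    -- (k+1)` and so the next factorial. The outer `g t` is kept as it stands, being only in `L_p`.
    refine (integral_mono_of_ae (integrable_absSum _) hri ih ht).trans_eq ?_
    have htu : t ∈ uIcc a b := by rwa [uIcc_of_le hab.le]
    have h2 : ∀ s, g s * ((∫ r in a..s, g r) ^ k / k.factorial * C) =
        (C / k.factorial) * (g s * (∫ r in a..s, g r) ^ k) := fun s ↦ by ring
    simp_rw [h2]
    rw [intervalIntegral.integral_const_mul, integral_mul_primitive_pow hgi k htu,
      Nat.factorial_succ]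
    push_cast
    field_simp

/-- In the pointwise bound, the outer `g t` contributes its `L_p` norm, and the integral of `absSum
v` contributes `m * toOneBound p a b * ‖v‖`, the norm on `Fin m → LpI p a b` being the maximum over
components. -/
theorem volterra_norm_pow_le (K : (Fin m → LpI p a b) →L[ℂ] (Fin m → LpI p a b)) {g : ℝ → ℝ}
    (hg : MemLp g p (volume.restrict (Icc a b))) (hg0 : ∀ t, 0 ≤ g t)
    (hK : ∀ v, ∀ᵐ t ∂(volume.restrict (Icc a b)),
      absSum (K v) t ≤ g t * ∫ s in a..t, absSum v s) (k : ℕ) :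
    ‖K ^ (k + 1)‖ ≤ (eLpNorm g p (volume.restrict (Icc a b))).toReal * (m * toOneBound p a b) *
      ((∫ s in a..b, g s) ^ k / k.factorial) := by
  have hab : a < b := Fact.out
  have hgi : Integrable g (volume.restrict (Icc a b)) := hg.integrable Fact.out
  have hG0 : 0 ≤ ∫ s in a..b, g s := intervalIntegral.integral_nonneg_of_forall hab.le hg0
  have hbound0 := toOneBound_nonneg p a b
  refine ContinuousLinearMap.opNorm_le_bound _ (by positivity) fun v ↦ ?_
  have hC : ∫ s in a..b, absSum v s ≤ m * toOneBound p a b * ‖v‖ := by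
    rw [intervalIntegral.integral_of_le hab.le, ← integral_Icc_eq_integral_Ioc]
    unfold absSum
    rw [integral_finsetSum _ fun i _ ↦ (LpI.integrable (v i)).norm]
    calc ∑ i, ∫ t in Icc a b, ‖v i t‖ ≤ ∑ _i : Fin m, toOneBound p a b * ‖v‖ :=
          Finset.sum_le_sum fun i _ ↦ (LpI.integral_norm_le (v i)).trans
            (mul_le_mul_of_nonneg_left (norm_le_pi_norm v i) hbound0)
      _ = m * toOneBound p a b * ‖v‖ := by simp [mul_assoc]
  have hC0 : 0 ≤ ∫ s in a..b, absSum v s :=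
    intervalIntegral.integral_nonneg_of_forall hab.le (absSum_nonneg v)
  have key : ∀ i, ‖((K ^ (k + 1)) v) i‖ ≤ ((∫ s in a..b, g s) ^ k / k.factorial *
      ∫ s in a..b, absSum v s) * (eLpNorm g p (volume.restrict (Icc a b))).toReal := by
    intro i
    set D := (∫ s in a..b, g s) ^ k / k.factorial * ∫ s in a..b, absSum v s
    have hD : 0 ≤ D := by positivity
    have h1 : eLpNorm (((K ^ (k + 1)) v) i) p (volume.restrict (Icc a b)) ≤
        ENNReal.ofReal D * eLpNorm g p (volume.restrict (Icc a b)) := by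
      refine eLpNorm_le_mul_eLpNorm_of_ae_le_mul ?_ p
      filter_upwards [volterra_pow_bound K hgi hg0 hK k v, ae_restrict_mem measurableSet_Icc]
        with t h2 ht
      have h3 : ‖((K ^ (k + 1)) v) i t‖ ≤ absSum ((K ^ (k + 1)) v) t :=
        Finset.single_le_sum (f := fun i ↦ ‖((K ^ (k + 1)) v) i t‖)
          (fun _ _ ↦ norm_nonneg _) (Finset.mem_univ i)
      refine (h3.trans h2).trans ?_
      rw [Real.norm_of_nonneg (hg0 t), mul_comm]
      refine mul_le_mul_of_nonneg_right ?_ (hg0 t)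
      refine mul_le_mul_of_nonneg_right ?_ hC0
      refine div_le_div_of_nonneg_right ?_ (by positivity)
      exact pow_le_pow_left₀ (intervalIntegral.integral_nonneg_of_forall ht.1 hg0)
        (integral_mono_right hgi hg0 ht.1 ht.2 le_rfl) k
    rw [Lp.norm_def]
    refine (ENNReal.toReal_mono (ENNReal.mul_ne_top ENNReal.ofReal_ne_top hg.2.ne) h1).trans_eq ?_
    rw [ENNReal.toReal_mul, ENNReal.toReal_ofReal hD]
  refine (pi_norm_le_iff_of_nonneg (by positivity)).2 fun i ↦ (key i).trans ?_
  calc _ ≤ ((∫ s in a..b, g s) ^ k / k.factorial * (m * toOneBound p a b * ‖v‖)) *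
        (eLpNorm g p (volume.restrict (Icc a b))).toReal := by gcongr
    _ = _ := by ring

/-- `1 - (-x)^k` is a unit by the Neumann series, and it factors as `1 + x` times a geometric sum.
Commuting factors of a unit are units. -/
theorem isUnit_one_add_of_norm_pow_lt_one {R : Type*} [NormedRing R] [CompleteSpace R] (x : R)
    (k : ℕ) (h : ‖x ^ k‖ < 1) : IsUnit (1 + x) := by
  have h1 : IsUnit (1 - (-x) ^ k) := by
    refine isUnit_one_sub_of_norm_lt_one ?_
    rw [neg_pow]
    rcases neg_one_pow_eq_or R k with h2 | h2 <;> simpa [h2] using h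
  rw [← mul_neg_geom_sum] at h1
  have hc : Commute (1 - -x) (∑ i ∈ Finset.range k, (-x) ^ i) :=
    Commute.sum_right _ _ _ fun i _ ↦
      ((Commute.one_left _).sub_left (Commute.refl _)).pow_right i
  have := (hc.isUnit_mul_iff.1 h1).1
  rwa [sub_neg_eq_add] at this

/-- Volterra equations of the second kind are uniquely solvable. -/
theorem volterra_bijective (K : (Fin m → LpI p a b) →L[ℂ] (Fin m → LpI p a b)) {g : ℝ → ℝ}
    (hg : MemLp g p (volume.restrict (Icc a b))) (hg0 : ∀ t, 0 ≤ g t)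
    (hK : ∀ v, ∀ᵐ t ∂(volume.restrict (Icc a b)),
      absSum (K v) t ≤ g t * ∫ s in a..t, absSum v s) :
    Function.Bijective fun v ↦ v + K v := by
  have hlim : Tendsto (fun k : ℕ ↦ (eLpNorm g p (volume.restrict (Icc a b))).toReal *
      (m * toOneBound p a b) * ((∫ s in a..b, g s) ^ k / k.factorial)) atTop (𝓝 0) := by
    simpa using (FloorSemiring.tendsto_pow_div_factorial_atTop (∫ s in a..b, g s)).const_mul
      ((eLpNorm g p (volume.restrict (Icc a b))).toReal * (m * toOneBound p a b))
  obtain ⟨k, hk⟩ := (hlim.eventually_lt_const one_pos).exists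
  have hu : IsUnit (1 + K) := isUnit_one_add_of_norm_pow_lt_one K (k + 1)
    ((volterra_norm_pow_le K hg hg0 hK k).trans_lt hk)
  obtain ⟨U, hU⟩ := hu
  have h1 : ∀ v, v + K v = (U : (Fin m → LpI p a b) →L[ℂ] (Fin m → LpI p a b)) v := fun v ↦ by
    rw [hU]; rfl
  simp_rw [h1]
  refine Function.bijective_iff_has_inverse.2
    ⟨((U⁻¹ : _) : (Fin m → LpI p a b) →L[ℂ] (Fin m → LpI p a b)), fun v ↦ ?_, fun v ↦ ?_⟩
  · exact congrArg (fun T : (Fin m → LpI p a b) →L[ℂ] (Fin m → LpI p a b) ↦ T v) U.inv_mul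
  · exact congrArg (fun T : (Fin m → LpI p a b) →L[ℂ] (Fin m → LpI p a b) ↦ T v) U.mul_inv

end

end

/-! ### The differential system and its Cauchy problem. -/

section

variable {p : ℝ≥0∞} [Fact (1 ≤ p)] {a b : ℝ}

theorem eq_mulTop_of_ae {f h : LpI p a b} {w : LpI ∞ a b} {g : ℝ → ℂ}
    (hh : h =ᵐ[volume.restrict (Icc a b)] fun t ↦ f t * g t)
    (hw : w =ᵐ[volume.restrict (Icc a b)] g) : h = mulTop f w := by
  refine Lp.ext ?_
  filter_upwards [hh, hw, coeFn_mulTop f w] with t h1 h2 h3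
  rw [h1, h3, h2]

variable [Fact (a < b)]

/-- Each integration costs at most a factor `b - a`. The upper limit stays at `t`, which preserves
the Volterra structure. -/
theorem integral_norm_primitive_pow_le (k : ℕ) (v : LpI p a b) {t : ℝ} (ht : t ∈ Icc a b) :
    ∫ s in a..t, ‖(primitive ^ k) v s‖ ≤ (b - a) ^ k * ∫ s in a..t, ‖v s‖ := by
  have hab : a < b := Fact.out
  induction k generalizing v with
  | zero => simp
  | succ k ih =>
    rw [pow_succ primitive k]
    refine (ih (primitive v)).trans ?_
    rw [pow_succ (b - a) k, mul_assoc]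
    refine mul_le_mul_of_nonneg_left ?_ (by have := sub_pos.2 hab; positivity)
    have h1 : ∫ s in a..t, ‖primitive v s‖ ≤ ∫ _s in a..t, ∫ r in a..t, ‖v r‖ := by
      refine intervalIntegral.integral_mono_ae_restrict ht.1
        (intervalIntegrable_of_integrable (LpI.integrable (primitive v)).norm ht)
        intervalIntegrable_const ?_
      filter_upwards [ae_mono (Measure.restrict_mono (Icc_subset_Icc_right ht.2) le_rfl)
        (coeFn_primitive v), ae_restrict_mem measurableSet_Icc] with s hs hst
      rw [hs]
      exact (intervalIntegral.norm_integral_le_integral_norm hst.1).trans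
        (integral_mono_right v.integrable.norm (fun _ ↦ norm_nonneg _) hst.1 hst.2 ht.2)
    refine h1.trans ?_
    rw [intervalIntegral.integral_const, smul_eq_mul]
    exact mul_le_mul_of_nonneg_right (by linarith [ht.2])
      (intervalIntegral.integral_nonneg_of_forall ht.1 fun _ ↦ norm_nonneg _)

/-- The iterated primitive of order `k + 1`, with values in `L_∞`. -/
noncomputable def iteratedPrimitive (k : ℕ) : LpI p a b →L[ℂ] LpI ∞ a b :=
  primitiveTop.comp (primitive ^ k)

theorem coeFn_iteratedPrimitive (k : ℕ) (v : LpI p a b) :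
    iteratedPrimitive k v =ᵐ[volume.restrict (Icc a b)]
      fun t ↦ ∫ s in a..t, (primitive ^ k) v s :=
  coeFn_primitiveTop _

theorem norm_iteratedPrimitive_le (k : ℕ) (v : LpI p a b) :
    ∀ᵐ t ∂(volume.restrict (Icc a b)),
      ‖iteratedPrimitive k v t‖ ≤ (b - a) ^ k * ∫ s in a..t, ‖v s‖ := by
  filter_upwards [coeFn_iteratedPrimitive k v, ae_restrict_mem measurableSet_Icc] with t h1 ht
  rw [h1]
  exact (intervalIntegral.norm_integral_le_integral_norm ht.1).trans
    (integral_norm_primitive_pow_le k v ht)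

section Volterra

variable {m r : ℕ}

/-- The operator that sends `v = y^{(r)}` to `∑_{l < r} A_l y^{(l)}`, where `y` and its derivatives
of order less than `r` vanish at `a`. -/
noncomputable def volterraOp (A : Fin r → Fin m → Fin m → LpI p a b) :
    (Fin m → LpI p a b) →L[ℂ] (Fin m → LpI p a b) :=
  ContinuousLinearMap.pi fun i ↦ ∑ l, ∑ j,
    -- `l.rev` is `r - 1 - l`, and `iteratedPrimitive k` integrates `k + 1` times, so `v` is
    -- integrated `r - l` times, as `y^{(l)}` requires.
    ((mulTop (A l i j)).comp (iteratedPrimitive (l.rev : ℕ))).comp (ContinuousLinearMap.proj j)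

theorem volterraOp_apply (A : Fin r → Fin m → Fin m → LpI p a b) (v : Fin m → LpI p a b)
    (i : Fin m) :
    volterraOp A v i = ∑ l, ∑ j, mulTop (A l i j) (iteratedPrimitive (l.rev : ℕ) (v j)) := by
  simp [volterraOp]

/-- The kernel that dominates `volterraOp`. -/
noncomputable def volterraKernel (A : Fin r → Fin m → Fin m → LpI p a b) (t : ℝ) : ℝ :=
  ∑ i, ∑ l : Fin r, ∑ j, ‖A l i j t‖ * (b - a) ^ (l.rev : ℕ)

theorem volterraOp_bound (A : Fin r → Fin m → Fin m → LpI p a b) (v : Fin m → LpI p a b) :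
    ∀ᵐ t ∂(volume.restrict (Icc a b)),
      absSum (volterraOp A v) t ≤ volterraKernel A t * ∫ s in a..t, absSum v s := by
  have hab : a < b := Fact.out
  have h1 : ∀ᵐ t ∂(volume.restrict (Icc a b)), ∀ i, volterraOp A v i t =
      ∑ l, ∑ j, A l i j t * iteratedPrimitive (l.rev : ℕ) (v j) t := by
    rw [ae_all_iff]
    intro i
    rw [volterraOp_apply]
    have h2 : ∀ᵐ t ∂(volume.restrict (Icc a b)), ∀ l j,
        mulTop (A l i j) (iteratedPrimitive (l.rev : ℕ) (v j)) t =
          A l i j t * iteratedPrimitive (l.rev : ℕ) (v j) t := by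
      simp_rw [ae_all_iff]
      exact fun l j ↦ coeFn_mulTop _ _
    have h3 : ∀ᵐ t ∂(volume.restrict (Icc a b)), ∀ l,
        (∑ j, mulTop (A l i j) (iteratedPrimitive (l.rev : ℕ) (v j)) : LpI p a b) t =
          ∑ j, mulTop (A l i j) (iteratedPrimitive (l.rev : ℕ) (v j)) t := by
      rw [ae_all_iff]
      exact fun l ↦ Lp.coeFn_fun_finsetSum _ _
    filter_upwards [Lp.coeFn_fun_finsetSum Finset.univ
      fun l ↦ ∑ j, mulTop (A l i j) (iteratedPrimitive (l.rev : ℕ) (v j)), h2, h3] with t h4 h5 h6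
    rw [h4]
    simp_rw [h6, h5]
  have h2 : ∀ᵐ t ∂(volume.restrict (Icc a b)), ∀ (l : Fin r) j,
      ‖iteratedPrimitive (l.rev : ℕ) (v j) t‖ ≤ (b - a) ^ (l.rev : ℕ) * ∫ s in a..t, ‖v j s‖ := by
    simp_rw [ae_all_iff]
    exact fun l j ↦ norm_iteratedPrimitive_le _ _
  filter_upwards [h1, h2, ae_restrict_mem measurableSet_Icc] with t h3 h4 ht
  have h5 : ∀ j, ∫ s in a..t, ‖v j s‖ ≤ ∫ s in a..t, absSum v s := fun j ↦
    integral_mono_of_ae (LpI.integrable (v j)).norm (integrable_absSum v)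
      (Eventually.of_forall fun s ↦ Finset.single_le_sum (f := fun j ↦ ‖v j s‖)
        (fun _ _ ↦ norm_nonneg _) (Finset.mem_univ j)) ht
  unfold absSum volterraKernel
  rw [Finset.sum_mul]
  refine Finset.sum_le_sum fun i _ ↦ ?_
  rw [h3, Finset.sum_mul]
  refine norm_sum_le_of_le _ fun l _ ↦ ?_
  rw [Finset.sum_mul]
  refine norm_sum_le_of_le _ fun j _ ↦ ?_
  rw [norm_mul, mul_assoc]
  refine mul_le_mul_of_nonneg_left ((h4 l j).trans ?_) (norm_nonneg _)
  exact mul_le_mul_of_nonneg_left (h5 j) (by have := sub_pos.2 hab; positivity)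

theorem volterraOp_bijective (A : Fin r → Fin m → Fin m → LpI p a b) :
    Function.Bijective fun v ↦ v + volterraOp A v := by
  have hab : a < b := Fact.out
  refine volterra_bijective (volterraOp A) (g := volterraKernel A) ?_ ?_ (volterraOp_bound A)
  · unfold volterraKernel
    exact memLp_finsetSum _ fun i _ ↦ memLp_finsetSum _ fun l _ ↦ memLp_finsetSum _ fun j _ ↦
      (Lp.memLp (A l i j)).norm.mul_const _
  · have := (sub_pos.2 hab).le
    exact fun t ↦ Finset.sum_nonneg fun i _ ↦ Finset.sum_nonneg fun l _ ↦
      Finset.sum_nonneg fun j _ ↦ by positivity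

end Volterra

section MatrixOp

variable {m : ℕ} {E F : Type*} [NormedAddCommGroup E] [NormedSpace ℂ E]
  [NormedAddCommGroup F] [NormedSpace ℂ F]

/-- The operator given by a matrix of operators. -/
noncomputable def matrixOp (T : Fin m → Fin m → E →L[ℂ] F) : (Fin m → E) →L[ℂ] (Fin m → F) :=
  ∑ i, ∑ j, (ContinuousLinearMap.single ℂ (fun _ : Fin m ↦ F) i).comp
    ((T i j).comp (ContinuousLinearMap.proj j))

theorem matrixOp_apply (T : Fin m → Fin m → E →L[ℂ] F) (y : Fin m → E) (i : Fin m) :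
    matrixOp T y i = ∑ j, T i j (y j) := by
  simp only [matrixOp, sum_apply, Finset.sum_apply]
  rw [Finset.sum_eq_single i]
  · simp
  · intro i' _ hi
    simp [hi.symm]
  · simp

theorem continuous_matrixOp {M : Type*} [TopologicalSpace M] {T : M → Fin m → Fin m → E →L[ℂ] F}
    (hT : ∀ i j, Continuous fun μ ↦ T μ i j) : Continuous fun μ ↦ matrixOp (T μ) :=
  continuous_finsetSum _ fun i _ ↦ continuous_finsetSum _ fun j _ ↦
    continuous_const.clm_comp ((hT i j).clm_comp continuous_const)

end MatrixOp

namespace Sobolev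

variable {m n r : ℕ}

/-- Integrate `w` successively `r` times. The last integration fixes the value of `u` itself, `q 0`,
so the induction runs on the tail of `q`. -/
theorem exists_derivCLM_eq (w : Sobolev n p a b) (q : Fin r → ℂ) :
    ∃ u : Sobolev (n + r) p a b, derivCLM r (by omega) u = w ∧
      ∀ s : Fin r, initial (s.castLE (by omega)) u = q s := by
  induction r with
  | zero =>
    refine ⟨w, Subtype.ext (PiLp.ext fun i ↦ ?_), fun s ↦ s.elim0⟩
    exact congrArg (fun i ↦ w.1 i) (Fin.ext (Nat.zero_add _))
  | succ r ih =>
    obtain ⟨u, hu, hq⟩ := ih fun s ↦ q s.succ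
    refine ⟨integrate (u, q 0), Subtype.ext (PiLp.ext fun i ↦ ?_), fun s ↦ ?_⟩
    · rw [← hu]
      have h : (⟨r + 1 + i, by omega⟩ : Fin (n + r + 1 + 1)) =
          (⟨r + i, by omega⟩ : Fin (n + r + 1)).succ := Fin.ext (by simp; omega)
      exact congrArg (fun i ↦ (integrate (u, q 0)).1 i) h
    · induction s using Fin.cases with
      | zero => exact initial_integrate_zero _
      | succ s => exact hq s

theorem eq_primitive_pow_of_initial_eq_zero {u : Sobolev (n + r) p a b}
    (hu : ∀ s : Fin r, initial (s.castLE (by omega)) u = 0) (d l : ℕ) (h : l + d = r) :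
    u.1 ⟨l, by omega⟩ = (primitive ^ d) (u.1 ⟨r, by omega⟩) := by
  induction d generalizing l with
  | zero =>
    obtain rfl : l = r := h
    rfl
  | succ d ih =>
    have h1 := eq_initial_add (⟨l, by omega⟩ : Fin (n + r)) u
    have h2 : initial (⟨l, by omega⟩ : Fin (n + r)) u = 0 := hu ⟨l, by omega⟩
    rw [h2, zero_smul, zero_add] at h1
    refine h1.trans ?_
    have h3 := ih (l + 1) (by omega)
    rw [pow_succ']
    exact congrArg primitive h3

theorem iteratedPrimitive_ae_eq {u : Sobolev (n + r) p a b}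
    (hu : ∀ s : Fin r, initial (s.castLE (by omega)) u = 0) (l : Fin r) :
    iteratedPrimitive (l.rev : ℕ) (u.1 ⟨r, by omega⟩) =ᵐ[volume.restrict (Icc a b)]
      u.1 ⟨l, by omega⟩ := by
  have h1 := eq_primitive_pow_of_initial_eq_zero hu ((l.rev : ℕ) + 1) l
    (by rw [Fin.val_rev]; omega)
  have h2 : u.1 ⟨l, by omega⟩ = primitive ((primitive ^ (l.rev : ℕ)) (u.1 ⟨r, by omega⟩)) := by
    rw [h1, pow_succ']
    rfl
  rw [h2]
  exact (coeFn_iteratedPrimitive (l.rev : ℕ) _).trans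
    (coeFn_primitive ((primitive ^ (l.rev : ℕ)) (u.1 ⟨r, by omega⟩))).symm

/-- The contribution of the `j`-th component of `y` to the `i`-th component of `L y`. -/
noncomputable def systemEntry (A : Fin r → SobolevMat m n p a b) (i j : Fin m) :
    Sobolev (n + r) p a b →L[ℂ] Sobolev n p a b :=
  (if i = j then derivCLM r (by omega) else 0) +
    ∑ l : Fin r, (mul n (A l (i, j))).comp
      (derivCLM (k := n + r) (l := n + 1) (l : ℕ) (by omega))

/-- The differential operator `L` of the system, from `(W^{n+r}_p)^m` to `(W^n_p)^m`. -/
noncomputable def systemOp (A : Fin r → SobolevMat m n p a b) :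
    (Fin m → Sobolev (n + r) p a b) →L[ℂ] (Fin m → Sobolev n p a b) :=
  matrixOp (systemEntry A)

theorem systemOp_apply (A : Fin r → SobolevMat m n p a b) (y : Fin m → Sobolev (n + r) p a b)
    (i : Fin m) : systemOp A y i = derivCLM r (by omega) (y i) +
      ∑ l : Fin r, ∑ j, mul n (A l (i, j)) (derivCLM (l : ℕ) (by omega) (y j)) := by
  rw [systemOp, matrixOp_apply, Finset.sum_comm]
  have h : ∀ j, systemEntry A i j (y j) = (if i = j then derivCLM r (by omega) (y j) else 0) +
      ∑ l : Fin r, mul n (A l (i, j)) (derivCLM (l : ℕ) (by omega) (y j)) := fun j ↦ by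
    unfold systemEntry
    rw [add_apply, sum_apply]
    congr 1
    split_ifs <;> rfl
  simp_rw [h]
  rw [Finset.sum_add_distrib, Finset.sum_ite_eq]
  simp

/-- Boundedness of the bilinear `mul n` turns convergence of the coefficients in `W^n_p` into
convergence of operators in norm. -/
theorem continuous_systemOp {M : Type*} [TopologicalSpace M]
    {A : M → Fin r → SobolevMat m n p a b} (hA : ∀ l, Continuous fun μ ↦ A μ l) :
    Continuous fun μ ↦ systemOp (A μ) := by
  refine continuous_matrixOp fun i j ↦ ?_
  unfold systemEntry
  refine continuous_const.add (continuous_finsetSum _ fun l _ ↦ ?_)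
  have h : Continuous fun μ ↦ mul n (A μ l (i, j)) :=
    (mul n).continuous.comp ((PiLp.continuous_apply _ _ (i, j)).comp (hA l))
  exact h.clm_comp continuous_const

theorem zero_component_add (u v : Sobolev n p a b) : (u + v).1 0 = u.1 0 + v.1 0 := rfl

theorem zero_component_sub (u v : Sobolev n p a b) : (u - v).1 0 = u.1 0 - v.1 0 := rfl

theorem zero_component_sum {ι : Type*} (s : Finset ι) (u : ι → Sobolev n p a b) :
    (∑ i ∈ s, u i).1 0 = ∑ i ∈ s, (u i).1 0 :=
  map_sum (derivLp 0) u s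

/-- For zero initial data the lower derivatives are iterated primitives of `v = y^{(r)}`, so the
system is a Volterra equation for `v` in `L_p`. -/
theorem systemOp_zero_component (A : Fin r → SobolevMat m n p a b)
    (y : Fin m → Sobolev (n + r) p a b)
    (hy : ∀ j, ∀ s : Fin r, initial (s.castLE (by omega)) (y j) = 0) (i : Fin m) :
    (systemOp A y i).1 0 = (y i).1 ⟨r, by omega⟩ +
      volterraOp (fun l i j ↦ (A l (i, j)).1 0) (fun j ↦ (y j).1 ⟨r, by omega⟩) i := by
  rw [systemOp_apply, volterraOp_apply, zero_component_add]
  refine congrArg (fun u : LpI p a b ↦ (y i).1 ⟨r, by omega⟩ + u) ?_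
  rw [zero_component_sum]
  refine Finset.sum_congr rfl fun l _ ↦ ?_
  rw [zero_component_sum]
  refine Finset.sum_congr rfl fun j _ ↦ ?_
  exact eq_mulTop_of_ae (coeFn_mul n _ _) (iteratedPrimitive_ae_eq (hy j) l)

/-- Solutions of the system are as regular as its data allow. -/
theorem exists_regular (A : Fin r → SobolevMat m n p a b) (f : Fin m → Sobolev n p a b)
    {v : Fin m → LpI p a b}
    (hv : ∀ i, v i + volterraOp (fun l i j ↦ (A l (i, j)).1 0) v i = (f i).1 0)
    {k : ℕ} (hk : k ≤ n) : ∃ w : Fin m → Sobolev k p a b, ∀ i, (w i).1 0 = v i := by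
  induction k with
  | zero => exact ⟨fun i ↦ ofLp (v i), fun i ↦ rfl⟩
  | succ k ih =>
    obtain ⟨w, hw⟩ := ih (by omega)
    -- Bootstrap: with `v` in `W^k_p`, its `r`-fold primitive `z` has derivatives of order less than
    -- `r` in `W^{k+1}_p`. As `k + 1 ≤ n`, so are the coefficients, their products with these
    -- derivatives, and `v = f - Kv`.
    choose z hz hz0 using fun j ↦ exists_derivCLM_eq (r := r) (w j) 0
    have hzr : ∀ j, (z j).1 ⟨r, by omega⟩ = v j := fun j ↦ by
      rw [← hw, ← hz j]
      rfl
    refine ⟨fun i ↦ derivCLM 0 (by omega) (f i) - ∑ l : Fin r, ∑ j,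
      mulSucc (mul k) (derivCLM 0 (by omega) (A l (i, j)))
        (derivCLM (l : ℕ) (by omega) (z j)), fun i ↦ ?_⟩
    rw [← add_sub_cancel_right (v i) (volterraOp (fun l i j ↦ (A l (i, j)).1 0) v i), hv,
      volterraOp_apply, zero_component_sub]
    refine congrArg (fun u : LpI p a b ↦ (f i).1 0 - u) ?_
    rw [zero_component_sum]
    refine Finset.sum_congr rfl fun l _ ↦ ?_
    rw [zero_component_sum]
    refine Finset.sum_congr rfl fun j _ ↦ ?_
    refine eq_mulTop_of_ae (coeFn_mulSucc (coeFn_mul k) _ _) ?_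
    rw [← hzr j]
    exact iteratedPrimitive_ae_eq (hz0 j) l

/-- The values at `a` of the derivatives of order less than `r`. -/
noncomputable def initialOp :
    (Fin m → Sobolev (n + r) p a b) →L[ℂ] (Fin m → Fin r → ℂ) :=
  ContinuousLinearMap.pi fun j ↦ ContinuousLinearMap.pi fun s : Fin r ↦
    (initial (s.castLE (by omega))).comp (ContinuousLinearMap.proj j)

theorem initialOp_apply (y : Fin m → Sobolev (n + r) p a b) (j : Fin m) (s : Fin r) :
    initialOp y j s = initial (s.castLE (by omega)) (y j) := rfl

/-- The initial-value problem is well posed. -/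
theorem systemOp_prod_initialOp_bijective (A : Fin r → SobolevMat m n p a b) :
    Function.Bijective ((systemOp A).prod initialOp) := by
  constructor
  · rw [injective_iff_map_eq_zero]
    intro y hy
    have h1 : systemOp A y = 0 := congrArg Prod.fst hy
    have h2 : ∀ j, ∀ s : Fin r, initial (s.castLE (by omega)) (y j) = 0 := fun j s ↦
      congrFun (congrFun (congrArg Prod.snd hy) j) s
    have h3 : (fun j ↦ (y j).1 ⟨r, by omega⟩ : Fin m → LpI p a b) = 0 := by
      refine (volterraOp_bijective fun l i j ↦ (A l (i, j)).1 0).1 (funext fun i ↦ ?_)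
      simp only [map_zero, add_zero]
      refine (systemOp_zero_component A y h2 i).symm.trans ?_
      rw [h1]
      rfl
    funext j
    refine ext_zero ?_
    refine (eq_primitive_pow_of_initial_eq_zero (h2 j) r 0 (by omega)).trans ?_
    have h4 : (y j).1 ⟨r, by omega⟩ = 0 := congrFun h3 j
    rw [h4, map_zero]
    rfl
  · rintro ⟨f, q⟩
    -- `τ` carries the prescribed initial data; subtracting it leaves a problem with zero initial
    -- data.
    choose τ _ hτ using fun j ↦ exists_derivCLM_eq (r := r) (0 : Sobolev n p a b) (q j)
    obtain ⟨v, hv⟩ := (volterraOp_bijective fun l i j ↦ (A l (i, j)).1 0).2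
      fun i ↦ ((f - systemOp A τ) i).1 0
    -- The Volterra equation gives `v` in `L_p` only; regularity places it in `W^n_p`, so that its
    -- `r`-fold primitive lies in `W^{n+r}_p`.
    obtain ⟨w, hw⟩ := exists_regular A (f - systemOp A τ) (fun i ↦ congrFun hv i) le_rfl
    choose z hz hz0 using fun j ↦ exists_derivCLM_eq (r := r) (w j) 0
    have hzr : (fun j ↦ (z j).1 ⟨r, by omega⟩) = v := by
      funext j
      rw [← hw, ← hz j]
      rfl
    have hLz : systemOp A z = f - systemOp A τ := by
      funext i
      refine ext_zero ?_
      refine (systemOp_zero_component A z hz0 i).trans ?_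
      rw [hzr]
      exact (congrArg (· + _) (congrFun hzr i)).trans (congrFun hv i)
    refine ⟨z + τ, Prod.ext ?_ ?_⟩
    · change systemOp A (z + τ) = f
      rw [map_add, hLz, sub_add_cancel]
    · change initialOp (z + τ) = q
      funext j s
      rw [initialOp_apply, Pi.add_apply, map_add, hz0, hτ, Pi.zero_apply, zero_add]

end Sobolev

end

/-! ### Continuous dependence for abstract operator equations. -/

section Abstract

variable {M X Y Q Z : Type*} [TopologicalSpace M]
  [NormedAddCommGroup X] [NormedSpace ℂ X] [CompleteSpace X]
  [NormedAddCommGroup Y] [NormedSpace ℂ Y]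
  [NormedAddCommGroup Z] [NormedSpace ℂ Z]

/-- Strongly continuous families of operators act continuously on continuous families of
vectors. -/
theorem continuous_apply_of_strongly_continuous [FirstCountableTopology M]
    {B : M → X →L[ℂ] Z} (hB : ∀ x, Continuous fun μ ↦ B μ x) {x : M → X} (hx : Continuous x) :
    Continuous fun μ ↦ B μ (x μ) := by
  have : SequentialSpace M := inferInstance
  refine continuous_iff_seqContinuous.2 fun u μ hu ↦ ?_
  -- Convergent sequences are bounded, so along a sequence strong convergence supplies the pointwise
  -- bounds needed for Banach–Steinhaus.
  obtain ⟨C, hC⟩ : ∃ C, ∀ k, ‖B (u k)‖ ≤ C := by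
    refine banach_steinhaus fun z ↦ ?_
    obtain ⟨C, hC⟩ := (Metric.isBounded_range_of_tendsto _
      (((hB z).tendsto μ).comp hu)).exists_norm_le
    exact ⟨C, fun k ↦ hC _ ⟨k, rfl⟩⟩
  have h1 : Tendsto (fun k ↦ B (u k) (x (u k) - x μ)) atTop (𝓝 0) := by
    have h2 : Tendsto (fun k ↦ C * ‖x (u k) - x μ‖) atTop (𝓝 0) := by
      have := (((hx.tendsto μ).comp hu).sub_const (x μ)).norm.const_mul C
      simpa using this
    exact squeeze_zero_norm (fun k ↦ ((B (u k)).le_opNorm _).trans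
      (mul_le_mul_of_nonneg_right (hC k) (norm_nonneg _))) h2
  have h3 := h1.add (((hB (x μ)).tendsto μ).comp hu)
  simpa [Function.comp_def] using h3

/-- The open mapping theorem makes each inverse bounded, and inversion is norm continuous at
invertible operators. -/
theorem continuous_inverse_of_bijective {X Y : Type*} [NormedAddCommGroup X] [NormedSpace ℂ X]
    [CompleteSpace X] [NormedAddCommGroup Y] [NormedSpace ℂ Y] [CompleteSpace Y]
    {T : M → X →L[ℂ] Y} (hT : Continuous T) (hb : ∀ μ, Function.Bijective (T μ)) :
    ∃ S : M → Y →L[ℂ] X, Continuous S ∧ (∀ μ y, T μ (S μ y) = y) ∧ ∀ μ x, S μ (T μ x) = x := by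
  let e : ∀ μ, X ≃L[ℂ] Y := fun μ ↦ ContinuousLinearEquiv.ofBijective (T μ)
    (LinearMap.ker_eq_bot.2 (hb μ).1) (LinearMap.range_eq_top.2 (hb μ).2)
  have he : ∀ μ, (e μ : X →L[ℂ] Y) = T μ := fun μ ↦ rfl
  refine ⟨fun μ ↦ (e μ).symm, ?_, fun μ y ↦ (e μ).apply_symm_apply y,
    fun μ x ↦ (e μ).symm_apply_apply x⟩
  have h : (fun μ ↦ ((e μ).symm : Y →L[ℂ] X)) = fun μ ↦ (T μ).inverse := by
    funext μ
    rw [← he, ContinuousLinearMap.inverse_equiv]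
  rw [h, continuous_iff_continuousAt]
  intro μ
  have := (contDiffAt_map_inverse (𝕜 := ℂ) (n := 0) (e μ)).continuousAt
  rw [he] at this
  exact ContinuousAt.comp (f := T) this hT.continuousAt

/-- Continuous dependence for an operator equation `(T x).1 = f`, `B x = c`, where `T` is an
isomorphism that depends continuously on the parameter, and `B` depends strongly continuously
on it. -/
theorem exists_continuous_solution [FirstCountableTopology M] [CompleteSpace Y]
    [NormedAddCommGroup Q] [NormedSpace ℂ Q]
    [FiniteDimensional ℂ Q] [FiniteDimensional ℂ Z]
    (hdim : Module.finrank ℂ Q = Module.finrank ℂ Z) {T : M → X →L[ℂ] Y × Q}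
    (hT : Continuous T) (hb : ∀ μ, Function.Bijective (T μ)) {B : M → X →L[ℂ] Z}
    (hB : ∀ x, Continuous fun μ ↦ B μ x) (h0 : ∀ μ x, (T μ x).1 = 0 → B μ x = 0 → x = 0)
    (f : Y) (c : Z) :
    ∃ y : C(M, X), ∀ μ x, ((T μ x).1 = f ∧ B μ x = c) ↔ x = y μ := by
  have : CompleteSpace Q := FiniteDimensional.complete ℂ Q
  have : CompleteSpace Z := FiniteDimensional.complete ℂ Z
  obtain ⟨S, hS, hTS, hST⟩ := continuous_inverse_of_bijective hT hb
  -- The characteristic matrix: the boundary values of the homogeneous solution with initial data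
  -- `q`.
  let N : M → Q →L[ℂ] Z := fun μ ↦ (B μ).comp ((S μ).comp (ContinuousLinearMap.inr ℂ Y Q))
  have hNa : ∀ μ q, N μ q = B μ (S μ (0, q)) := fun μ q ↦ rfl
  have hBS : ∀ {z : M → Y × Q}, Continuous z → Continuous fun μ ↦ B μ (S μ (z μ)) := fun hz ↦
    continuous_apply_of_strongly_continuous hB (hS.clm_apply hz)
  have hN : Continuous N := by
    -- `Q` is finite-dimensional, so strong continuity of `N` is norm continuity.
    rw [continuous_clm_apply]
    exact fun q ↦ hBS continuous_const
  have hNinj : ∀ μ, Function.Injective (N μ) := fun μ ↦ by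
    rw [injective_iff_map_eq_zero]
    intro q hq
    have h1 := h0 μ (S μ (0, q)) (by rw [hTS]) hq
    have h2 := hTS μ (0, q)
    rw [h1, map_zero] at h2
    exact (congrArg Prod.snd h2).symm
  have hNb : ∀ μ, Function.Bijective (N μ) := fun μ ↦
    ⟨hNinj μ, (LinearMap.injective_iff_surjective_of_finrank_eq_finrank
      (f := (N μ : Q →ₗ[ℂ] Z)) hdim).1 (hNinj μ)⟩
  obtain ⟨R, hR, hNR, hRN⟩ := continuous_inverse_of_bijective hN hNb
  -- The only initial data for which the solution of the equation meets the boundary condition.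
  let q : M → Q := fun μ ↦ R μ (c - B μ (S μ (f, 0)))
  have hq : Continuous q := hR.clm_apply (continuous_const.sub (hBS continuous_const))
  have hsplit : ∀ μ (s : Q), B μ (S μ (f, s)) = B μ (S μ (f, 0)) + N μ s := fun μ s ↦ by
    rw [hNa, ← map_add, ← map_add]
    simp
  refine ⟨⟨fun μ ↦ S μ (f, q μ), hS.clm_apply (continuous_const.prodMk hq)⟩,
    fun μ x ↦ ⟨fun ⟨h1, h2⟩ ↦ ?_, ?_⟩⟩
  · have hx : x = S μ (f, (T μ x).2) := by
      rw [← h1, Prod.mk.eta, hST]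
    have : (T μ x).2 = q μ := by
      apply hNinj μ
      rw [hNR, ← h2, hx, hTS, hsplit]
      simp
    rw [hx, this]
    rfl
  · rintro rfl
    refine ⟨?_, ?_⟩
    · change (T μ (S μ (f, q μ))).1 = f
      rw [hTS]
    · change B μ (S μ (f, q μ)) = c
      rw [hsplit, hNR]
      abel

end Abstract

/-! ### From the pointwise boundary-value problem to the operator equation. -/

section

variable {p : ℝ≥0∞} [Fact (1 ≤ p)] {a b : ℝ} [Fact (a < b)] {m n r : ℕ}

theorem Sobolev.ae_eq_deriv {k : ℕ} (u : Sobolev k p a b) {s : ℕ} (hs : s < k + 1) :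
    u.1 ⟨s, hs⟩ =ᵐ[volume.restrict (Icc a b)] Sobolev.deriv s u :=
  u.toFun_spec.2 ⟨s, hs⟩

theorem Sobolev.ae_eq_toFun {k : ℕ} (u : Sobolev k p a b) :
    u.1 0 =ᵐ[volume.restrict (Icc a b)] u.toFun := by
  simpa using u.toFun_spec.2 0

theorem Sobolev.continuousOn_deriv {k : ℕ} (u : Sobolev k p a b) {s : ℕ} (hs : s < k) :
    ContinuousOn (Sobolev.deriv s u) (Icc a b) := by
  have hab : a < b := Fact.out
  obtain ⟨k, rfl⟩ : ∃ k', k = k' + 1 := ⟨k - 1, by omega⟩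
  have := (u.toFun_spec.1.absolutelyContinuous (Nat.lt_succ_iff.1 hs)).continuousOn
  rwa [uIcc_of_le hab.le] at this

theorem Sobolev.continuousOn_toFun {k : ℕ} (u : Sobolev k p a b) (hk : 1 ≤ k) :
    ContinuousOn u.toFun (Icc a b) := by
  have h := u.continuousOn_deriv (s := 0) (by omega)
  have h0 : Sobolev.deriv 0 u = u.toFun := funext fun t ↦ by
    rw [Sobolev.deriv, iteratedDerivWithin_zero]
  rwa [h0] at h

theorem continuousOn_diffExpr (hn : 1 ≤ n) (A : Fin r → SobolevMat m n p a b)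
    (y : SobolevVec m (n + r) p a b) (i : Fin m) :
    ContinuousOn (fun t ↦ diffExpr A y t i) (Icc a b) := by
  unfold diffExpr
  refine ((y i).continuousOn_deriv (by omega)).add (continuousOn_finsetSum _ fun l _ ↦
    continuousOn_finsetSum _ fun j _ ↦ ?_)
  exact ((A l (i, j)).continuousOn_toFun hn).mul ((y j).continuousOn_deriv (by omega))

theorem systemOp_ae_eq_diffExpr (A : Fin r → SobolevMat m n p a b)
    (y : SobolevVec m (n + r) p a b) (i : Fin m) :
    (Sobolev.systemOp A (fun j ↦ y j) i).1 0 =ᵐ[volume.restrict (Icc a b)]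
      fun t ↦ diffExpr A y t i := by
  rw [Sobolev.systemOp_apply, Sobolev.zero_component_add, Sobolev.zero_component_sum]
  simp_rw [Sobolev.zero_component_sum]
  have h1 : ∀ᵐ t ∂(volume.restrict (Icc a b)), ∀ (l : Fin r) j,
      (Sobolev.mul n (A l (i, j)) (Sobolev.derivCLM (l : ℕ) (by omega) (y j))).1 0 t =
        (A l (i, j)).toFun t * Sobolev.deriv (l : ℕ) (y j) t := by
    simp_rw [ae_all_iff]
    intro l j
    filter_upwards [Sobolev.coeFn_mul n (A l (i, j))
      (Sobolev.derivCLM (l : ℕ) (by omega) (y j)), (A l (i, j)).ae_eq_toFun,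
      (y j).ae_eq_deriv (s := l) (by omega)] with t h1 h2 h3
    rw [h1, h2]
    exact congrArg (_ * ·) h3
  have h2 : ∀ᵐ t ∂(volume.restrict (Icc a b)), ∀ l : Fin r,
      (∑ j, (Sobolev.mul n (A l (i, j)) (Sobolev.derivCLM (l : ℕ) (by omega) (y j))).1 0 :
        LpI p a b) t =
      ∑ j, (Sobolev.mul n (A l (i, j)) (Sobolev.derivCLM (l : ℕ) (by omega) (y j))).1 0 t := by
    rw [ae_all_iff]
    exact fun l ↦ Lp.coeFn_fun_finsetSum _ _
  refine (Lp.coeFn_add _ _).trans ?_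
  filter_upwards [h1, h2, (y i).ae_eq_deriv (s := r) (by omega),
    Lp.coeFn_fun_finsetSum Finset.univ fun l : Fin r ↦
      (∑ j, (Sobolev.mul n (A l (i, j)) (Sobolev.derivCLM (l : ℕ) (by omega) (y j))).1 0 :
        LpI p a b)] with t h3 h4 h5 h6
  rw [Pi.add_apply, h6]
  simp_rw [h4, h3]
  exact congrArg (· + _) h5

/-- For `n ≥ 1` both sides are continuous on `[a, b]`, so almost everywhere means everywhere. For `n
= 0` only the null set of endpoints is added. -/
theorem solvesSystem_iff_ae (A : Fin r → SobolevMat m n p a b) (f : SobolevVec m n p a b)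
    (y : SobolevVec m (n + r) p a b) : SolvesSystem A f y ↔
      ∀ i, (fun t ↦ diffExpr A y t i) =ᵐ[volume.restrict (Icc a b)] (f i).toFun := by
  have hab : a < b := Fact.out
  have hIoo : volume.restrict (Ioo a b) = volume.restrict (Icc a b) :=
    Measure.restrict_congr_set Ioo_ae_eq_Icc
  rcases Nat.eq_zero_or_pos n with hn | hn
  · have h : SolvesSystem A f y ↔
        ∀ᵐ t ∂(volume.restrict (Ioo a b)), ∀ i, diffExpr A y t i = (f i).toFun t :=
      ⟨fun h ↦ h.2 hn, fun h ↦ ⟨fun h' ↦ by omega, fun _ ↦ h⟩⟩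
    rw [h, hIoo, ae_all_iff]
    rfl
  · have h : SolvesSystem A f y ↔
        ∀ t ∈ Ioo a b, ∀ i, diffExpr A y t i = (f i).toFun t :=
      ⟨fun h ↦ h.1 hn, fun h ↦ ⟨fun _ ↦ h, fun h' ↦ by omega⟩⟩
    rw [h]
    constructor
    · intro h i
      rw [← hIoo]
      filter_upwards [ae_restrict_mem measurableSet_Ioo] with t ht using h t ht i
    · intro h t ht i
      exact Measure.eqOn_Icc_of_ae_eq volume hab.ne (h i) (continuousOn_diffExpr hn A y i)
        ((f i).continuousOn_toFun hn) (Ioo_subset_Icc_self ht)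

theorem solvesSystem_iff (A : Fin r → SobolevMat m n p a b) (f : SobolevVec m n p a b)
    (y : SobolevVec m (n + r) p a b) :
    SolvesSystem A f y ↔ Sobolev.systemOp A (fun j ↦ y j) = fun i ↦ f i := by
  rw [solvesSystem_iff_ae, funext_iff]
  refine forall_congr' fun i ↦ ⟨fun h ↦ Sobolev.ext_zero (Lp.ext ?_), fun h ↦ ?_⟩
  · exact (systemOp_ae_eq_diffExpr A y i).trans (h.trans (f i).ae_eq_toFun.symm)
  · refine (systemOp_ae_eq_diffExpr A y i).symm.trans ?_
    rw [h]
    exact (f i).ae_eq_toFun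

/-- The system operator together with the initial values, on `(W^{n+r}_p)^m`. -/
noncomputable def cauchyOp (A : Fin r → SobolevMat m n p a b) :
    SobolevVec m (n + r) p a b →L[ℂ] (Fin m → Sobolev n p a b) × (Fin m → Fin r → ℂ) :=
  ((Sobolev.systemOp A).prod Sobolev.initialOp).comp
    (PiLp.continuousLinearEquiv 1 ℂ fun _ : Fin m ↦ Sobolev (n + r) p a b :
      SobolevVec m (n + r) p a b →L[ℂ] Fin m → Sobolev (n + r) p a b)

theorem cauchyOp_fst (A : Fin r → SobolevMat m n p a b) (y : SobolevVec m (n + r) p a b) :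
    (cauchyOp A y).1 = Sobolev.systemOp A (fun j ↦ y j) := rfl

theorem cauchyOp_bijective (A : Fin r → SobolevMat m n p a b) :
    Function.Bijective (cauchyOp A) :=
  (Sobolev.systemOp_prod_initialOp_bijective A).comp
    (PiLp.continuousLinearEquiv 1 ℂ fun _ : Fin m ↦ Sobolev (n + r) p a b).bijective

theorem continuous_cauchyOp {M : Type*} [TopologicalSpace M]
    {A : M → Fin r → SobolevMat m n p a b} (hA : ∀ l, Continuous fun μ ↦ A μ l) :
    Continuous fun μ ↦ cauchyOp (A μ) := by
  have h1 : Continuous fun μ ↦ (Sobolev.systemOp (A μ)).prod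
      (Sobolev.initialOp : (Fin m → Sobolev (n + r) p a b) →L[ℂ] _) :=
    (ContinuousLinearMap.prodₗᵢ (𝕜 := ℂ) ℂ).continuous.comp
      ((Sobolev.continuous_systemOp hA).prodMk continuous_const)
  exact h1.clm_comp continuous_const

theorem isSolution_iff (A : Fin r → SobolevMat m n p a b)
    (B : SobolevVec m (n + r) p a b →L[ℂ] EuclideanSpace ℂ (Fin (r * m)))
    (f : SobolevVec m n p a b) (c : EuclideanSpace ℂ (Fin (r * m)))
    (y : SobolevVec m (n + r) p a b) :
    IsSolution A B f c y ↔ (cauchyOp A y).1 = (fun i ↦ f i) ∧ B y = c := by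
  rw [IsSolution, solvesSystem_iff, cauchyOp_fst]

/-- The equivalence yields existence and uniqueness for every `μ`, with the same `y` continuous in
`μ`. -/
theorem exists_continuous_isSolution {M : Type*} [MetricSpace M]
    (A : M → Fin r → SobolevMat m n p a b)
    (B : M → SobolevVec m (n + r) p a b →L[ℂ] EuclideanSpace ℂ (Fin (r * m)))
    (f : SobolevVec m n p a b) (c : EuclideanSpace ℂ (Fin (r * m)))
    (h0 : ∀ μ, ConditionZero (A μ) (B μ)) (hI : ∀ μ, LimitConditionI A μ)
    (hII : ∀ μ, LimitConditionII B μ) :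
    ∃ y : C(M, SobolevVec m (n + r) p a b), ∀ μ x, IsSolution (A μ) (B μ) f c x ↔ x = y μ := by
  have hA : ∀ l, Continuous fun μ ↦ A μ l := fun l ↦
    continuous_iff_continuousAt.2 fun μ ↦ hI μ l
  have hB : ∀ y, Continuous fun μ ↦ B μ y := fun y ↦
    continuous_iff_continuousAt.2 fun μ ↦ hII μ y
  have hdim : Module.finrank ℂ (Fin m → Fin r → ℂ) =
      Module.finrank ℂ (EuclideanSpace ℂ (Fin (r * m))) := by
    simp [Module.finrank_pi_fintype, mul_comm]
  obtain ⟨y, hy⟩ := exists_continuous_solution hdim (continuous_cauchyOp hA)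
    (fun μ ↦ cauchyOp_bijective (A μ)) hB
    (fun μ x h1 h2 ↦ h0 μ x ((isSolution_iff _ _ _ _ _).2 ⟨h1, h2⟩)) (fun i ↦ f i) c
  exact ⟨y, fun μ x ↦ (isSolution_iff _ _ _ _ _).trans (hy μ x)⟩

end

end SobolevBVP

theorem mainTheorem8 {M : Type*} [MetricSpace M]
    (a b : ℝ) [Fact (a < b)] (p : ℝ≥0∞) [Fact (1 ≤ p)]
    (n m r : ℕ) (hm : 1 ≤ m) (hr : 1 ≤ r)
    (A : M → Fin r → SobolevBVP.SobolevMat m n p a b)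
    (B : M → SobolevBVP.SobolevVec m (n + r) p a b →L[ℂ] EuclideanSpace ℂ (Fin (r * m)))
    (f : SobolevBVP.SobolevVec m n p a b) (c : EuclideanSpace ℂ (Fin (r * m)))
    (h0 : ∀ μ, SobolevBVP.ConditionZero (A μ) (B μ))
    (hI : ∀ μ, SobolevBVP.LimitConditionI A μ)
    (hII : ∀ μ, SobolevBVP.LimitConditionII B μ) :
    (∀ μ, ∃! y, SobolevBVP.IsSolution (A μ) (B μ) f c y) ∧
    ∃ y : C(M, SobolevBVP.SobolevVec m (n + r) p a b),
      ∀ μ, SobolevBVP.IsSolution (A μ) (B μ) f c (y μ) := by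
  obtain ⟨y, hy⟩ := SobolevBVP.exists_continuous_isSolution A B f c h0 hI hII
  exact ⟨fun μ ↦ ⟨y μ, (hy μ _).2 rfl, fun x hx ↦ (hy μ x).1 hx⟩, y, fun μ ↦ (hy μ _).2 rfl⟩
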